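/- Consider integral binary quadratic forms $(A,B,C)=Ax^2+Bxy+Cy^2$ that are indefinite, i.e. whose discriminant $\Delta=B^2-4AC$ is positive and not a square, and call $SL_2(\mathbb{Z})$-equivalence classes of such forms classes. A class is primitive if its forms have $\gcd(A,B,C)=1$. A form is Z-reduced if $A,B,C>0$ and $B>A+C$; the Z-caliber $k_Z(\mathfrak c)$ of a class $\mathfrak c$ is the number of Z-reduced forms in it. For a Z-reduced form $f=(A,B,C)$ of discriminant $\Delta$, let $(t,u)$ be the solution of $|t^2-\Delta u^2|=4$ in positive integers with $u$ minimal (and then $t$ minimal; this matters only for $\Delta=5$), let $z=\frac{t+Bu}{2}$, and let $(q_1,\dots,q_m)$ be the regular continued fraction expansion, with positive partial quotients, of $\frac{z}{z-Au}$ with $m$ even if $t^2-\Delta u^2=-4$ and $m$ odd otherwise. Let $\sigma(f)$ be the binary string $0^{q_1-1}\,1\,0^{q_2-1}\,1\cdots 1\,0^{q_m-1}$. A binary necklace is a binary string up to cyclic permutation; its length is its number of beads and its weight its number of $1$s; it is primitive if it is nonempty and no nontrivial rotation fixes its strings. An alternating necklace is a binary necklace of even weight whose $1$s are coloured alternately in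 two colours (green and blue), up to rotations matching the colours; forgetting the colours gives its underlying binary necklace. Every class $\mathfrak c$ contains a Z-reduced form, and the necklace $\overline\sigma(\mathfrak c)$ of $\sigma(f)$ does not depend on the choice of the Z-reduced form $f\in\mathfrak c$. If this necklace has even weight, then the alternating necklace obtained by colouring the $1$s of $\sigma(f)$ alternately from left to right, beginning with green, does not depend on $f$ either. Moreover, for every primitive binary necklace $\overline{\mathfrak s}$ of length $l$: 1. If $\overline{\mathfrak s}$ has odd weight, there is a unique primitive class $\mathfrak c$ with $\overline\sigma(\mathfrak c)=\overline{\mathfrak s}$, and $l=k_Z(\mathfrak c)$. 2. If $\overline{\mathfrak s}$ has even nonzero weight, there are exactly two primitive classes $\mathfrak c_1\ne\mathfrak c_2$ whose alternating necklaces have underlying necklace $\overline{\mathfrak s}$, and $l=k_Z(\mathfrak c_1)+k_Z(\mathfrak c_2)$. -/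

import Mathlib

namespace ZNecklace

/-! ## Binary quadratic forms -/

/-- The integral binary quadratic form `A x² + B x y + C y²`. -/
@[ext]
structure BQF where
  A : ℤ
  B : ℤ
  C : ℤ

namespace BQF

/-- The discriminant `B² - 4AC`. -/
def disc (f : BQF) : ℤ := f.B ^ 2 - 4 * f.A * f.C

/-- The value `f(x, y)`. -/
def eval (f : BQF) (x y : ℤ) : ℤ := f.A * x ^ 2 + f.B * x * y + f.C * y ^ 2

/-- The form has relatively prime coefficients. -/
def IsPrimitive (f : BQF) : Prop := Int.gcd (Int.gcd f.A f.B) f.C = 1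

/-- The right action of `[α β; γ δ] ∈ SL₂(ℤ)`: the form `f(α x + β y, γ x + δ y)`. -/
def act (f : BQF) (M : Matrix.SpecialLinearGroup (Fin 2) ℤ) : BQF where
  A := f.A * M 0 0 ^ 2 + f.B * M 0 0 * M 1 0 + f.C * M 1 0 ^ 2
  B := 2 * f.A * M 0 0 * M 0 1 + f.B * (M 0 0 * M 1 1 + M 0 1 * M 1 0)
    + 2 * f.C * M 1 0 * M 1 1
  C := f.A * M 0 1 ^ 2 + f.B * M 0 1 * M 1 1 + f.C * M 1 1 ^ 2

/-- The coefficients in `act` are those of the substituted form. -/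
theorem eval_act (f : BQF) (M : Matrix.SpecialLinearGroup (Fin 2) ℤ) (x y : ℤ) :
    (f.act M).eval x y = f.eval (M 0 0 * x + M 0 1 * y) (M 1 0 * x + M 1 1 * y) := by
  simp only [eval, act]; ring

theorem act_one (f : BQF) : f.act 1 = f := by
  ext <;> simp [act]

theorem act_mul (f : BQF) (M N : Matrix.SpecialLinearGroup (Fin 2) ℤ) :
    f.act (M * N) = (f.act M).act N := by
  ext <;> simp [act, Matrix.mul_apply, Fin.sum_univ_two] <;> ring

end BQF

/-- Indefinite forms: those with positive, nonsquare discriminant. -/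
def IndefForm : Type := {f : BQF // 0 < f.disc ∧ ¬ IsSquare f.disc}

/-- Proper equivalence of indefinite forms. -/
instance formSetoid : Setoid IndefForm where
  r f g := ∃ M : Matrix.SpecialLinearGroup (Fin 2) ℤ, g.1 = f.1.act M
  iseqv :=
    { refl := fun f => ⟨1, (f.1.act_one).symm⟩
      symm := by
        rintro f g ⟨M, h⟩
        exact ⟨M⁻¹, by rw [h, ← BQF.act_mul, mul_inv_cancel, BQF.act_one]⟩
      trans := by
        rintro f g k ⟨M, h⟩ ⟨N, h'⟩
        exact ⟨M * N, by rw [h', h, BQF.act_mul]⟩ }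

/-- Classes of indefinite forms. -/
def FormClass : Type := Quotient formSetoid

/-- The class of an indefinite form. -/
def IndefForm.toClass (f : IndefForm) : FormClass := Quotient.mk formSetoid f

/-- A form `(A, B, C)` is Z-reduced if `A, B, C > 0` and `B > A + C`. -/
def IndefForm.IsZReduced (f : IndefForm) : Prop :=
  0 < f.1.A ∧ 0 < f.1.B ∧ 0 < f.1.C ∧ f.1.A + f.1.C < f.1.B

/-- The set of Z-reduced forms in a class. -/
def FormClass.zForms (c : FormClass) : Set IndefForm :=
  {f | f.toClass = c ∧ f.IsZReduced}

/-- A class is primitive if all its forms are primitive. -/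
def FormClass.IsPrimitive (c : FormClass) : Prop :=
  ∀ f : IndefForm, f.toClass = c → f.1.IsPrimitive

/-- The Z-caliber of a class: the number of Z-reduced forms in it. -/
noncomputable def FormClass.zCaliber (c : FormClass) : ℕ∞ := c.zForms.encard

/-! ## The bead sequence and the string of a Z-reduced form -/

/-- `(t, u)` is a solution of `|t² - D u²| = 4` in positive integers. -/
def IsPellSol (D : ℤ) (t u : ℕ) : Prop :=
  0 < t ∧ 0 < u ∧ |(t : ℤ) ^ 2 - D * (u : ℤ) ^ 2| = 4

/-- The second component of the fundamental solution: the least possible `u`. -/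
noncomputable def pellU (D : ℤ) : ℕ := sInf {u : ℕ | ∃ t : ℕ, IsPellSol D t u}

/-- The first component of the fundamental solution. (It is determined by `u`, except that for
`D = 5` both `(1, 1)` and `(3, 1)` are solutions; then the smaller `t` is meant.) -/
noncomputable def pellT (D : ℤ) : ℕ := sInf {t : ℕ | IsPellSol D t (pellU D)}

/-- The value of the finite regular continued fraction with partial quotients `q`. -/
def cfValue : List ℕ → ℚ
  | [] => 0
  | [q] => q
  | q :: r :: l => q + 1 / cfValue (r :: l)

/-- `q` is the regular continued fraction expansion of `x` with positive partial quotients whose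
number is even if `e` holds, and odd otherwise. -/
def IsExpansion (x : ℚ) (e : Prop) (q : List ℕ) : Prop :=
  (∀ a ∈ q, 0 < a) ∧ q ≠ [] ∧ cfValue q = x ∧ (Even q.length ↔ e)

/-- `z = (t + B u) / 2`. -/
noncomputable def zOf (f : IndefForm) : ℚ :=
  ((pellT f.1.disc : ℚ) + f.1.B * pellU f.1.disc) / 2

/-- The bead sequence of `f`: the expansion of `z / (z - A u)` with an even number of partial
quotients if `t² - Δ u² = -4`, and an odd number otherwise. -/
noncomputable def beadSeq (f : IndefForm) : List ℕ :=
  Classical.epsilon (IsExpansion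
    (zOf f / (zOf f - f.1.A * pellU f.1.disc))
    ((pellT f.1.disc : ℤ) ^ 2 - f.1.disc * (pellU f.1.disc : ℤ) ^ 2 = -4))

/-- Stars and bars: `q₁ + ⋯ + qₗ` stars are divided by bars into bunches of sizes `q₁, …, qₗ`;
the gaps between consecutive stars are read from left to right, an empty gap giving `0` (`false`)
and a bar giving `1` (`true`). -/
def starsBars : List ℕ → List Bool
  | [] => []
  | [q] => List.replicate (q - 1) false
  | q :: r :: l => List.replicate (q - 1) false ++ true :: starsBars (r :: l)

/-- The binary string `σ(f)`. -/
noncomputable def sigma (f : IndefForm) : List Bool := starsBars (beadSeq f)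

/-! ## Necklaces

A binary necklace is a binary string up to cyclic permutation, that is, a `Cycle Bool`; its length
is `Cycle.length`. -/

/-- The weight of a binary necklace: the number of its `1`s. -/
def weight (s : Cycle Bool) : ℕ := s.toMultiset.count true

/-- A nonempty string of length `n` is primitive if no rotation by `k`, `0 < k < n`, fixes it. -/
def IsPrimitiveString (l : List Bool) : Prop :=
  l ≠ [] ∧ ∀ k : ℕ, 0 < k → k < l.length → l.rotate k ≠ l

/-- A necklace is primitive if its associated strings are primitive. -/
def IsPrimitiveNecklace (s : Cycle Bool) : Prop :=
  ∀ l : List Bool, (l : Cycle Bool) = s → IsPrimitiveString l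

/-- The beads of alternating strings: `0`, green `1` and blue `1`. -/
inductive Bead where
  | zero
  | green
  | blue
  deriving DecidableEq

/-- Forget the colour of a bead. -/
def Bead.toBool : Bead → Bool
  | .zero => false
  | .green => true
  | .blue => true

/-- Alternating strings: there is an even number of `1`s, and their colours alternate. -/
def IsAlternating (w : List Bead) : Prop :=
  Even ((w.map Bead.toBool).count true) ∧
    List.IsChain (· ≠ ·) (w.filter (fun b => b ≠ Bead.zero))

/-- The type of alternating strings. -/
def AltString : Type := {w : List Bead // IsAlternating w}

/-- Cyclic permutation of alternating strings, with matching colours. -/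
instance altSetoid : Setoid AltString where
  r v w := v.1.IsRotated w.1
  iseqv := ⟨fun v => List.IsRotated.refl v.1, fun h => h.symm, fun h h' => h.trans h'⟩

/-- Alternating necklaces. -/
def AltNecklace : Type := Quotient altSetoid

/-- The underlying binary necklace of an alternating necklace. -/
def AltNecklace.underlying : AltNecklace → Cycle Bool :=
  Quotient.lift (fun w : AltString => ((w.1.map Bead.toBool : List Bool) : Cycle Bool))
    (fun _ _ h => Cycle.coe_eq_coe.mpr (List.IsRotated.map h Bead.toBool))

/-- Colour the `1`s of a string alternately from left to right; the first `1` is green if `g` is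
true, and blue otherwise. -/
def colour : Bool → List Bool → List Bead
  | _, [] => []
  | g, false :: l => Bead.zero :: colour g l
  | g, true :: l => (if g then Bead.green else Bead.blue) :: colour (!g) l

theorem map_toBool_colour (l : List Bool) :
    ∀ g : Bool, (colour g l).map Bead.toBool = l := by
  induction l with
  | nil => intro g; rfl
  | cons a l ih => intro g; cases a <;> cases g <;> simp [colour, Bead.toBool, ih]

theorem isChain_colour (l : List Bool) :
    ∀ g : Bool, List.IsChain (· ≠ ·)
      ((if g then Bead.blue else Bead.green) :: (colour g l).filter (fun b => b ≠ Bead.zero)) := by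
  induction l with
  | nil => intro g; simp [colour]
  | cons a l ih =>
    intro g
    cases a
    · simpa [colour] using ih g
    · cases g
      · simpa [colour] using ih true
      · simpa [colour] using ih false

/-- The alternating necklace of a binary string of even weight, the first `1` of the string being
coloured green. -/
def altNecklace (l : List Bool) (h : Even (weight (l : Cycle Bool))) : AltNecklace :=
  Quotient.mk altSetoid ⟨colour true l, by
    rw [map_toBool_colour]
    simpa [weight] using h, (isChain_colour l true).tail⟩

/-! ## The map from classes of forms to necklaces -/

/-- An arbitrary Z-reduced form in the class `c`. -/
noncomputable def FormClass.zRep (c : FormClass) : IndefForm :=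
  haveI : Nonempty IndefForm := ⟨(Quotient.exists_rep c).choose⟩
  Classical.epsilon (fun f => f ∈ c.zForms)

/-- The binary necklace of a class: that of `σ(f)`, for an arbitrary Z-reduced form `f` in it. -/
noncomputable def sigmaBar (c : FormClass) : Cycle Bool := (sigma c.zRep : Cycle Bool)

/-- The alternating necklace of a class of even weight: that of `σ(f)`, the first `1` being
coloured green, for an arbitrary Z-reduced form `f` in the class. -/
noncomputable def altSigmaBar (c : FormClass) (h : Even (weight (sigmaBar c))) : AltNecklace :=
  altNecklace (sigma c.zRep) h

end ZNecklace

open ZNecklace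

namespace ZNecklace

open Matrix

/-! Pass from f to F(x, y) = -f(x + y, -x) (`toF`). Then f is Z-reduced exactly when F is positive
at (1, 0) and negative at (0, 1) and (1, -1): one isotropic line of F crosses the positive quadrant,
the other lies between (1, 0) and (1, -1). Let M in GL₂(ℤ) send F to det M • (F ∘ M), and let the
beads 0 and 1 act through [1 1; 0 1] and [0 1; 1 1]. The sign of F(1, 1) decides which single bead
keeps F reduced, so the strings that keep F reduced are prefixes of one another
(`prefix_of_length_le`).

The fundamental Pell solution gives a matrix `autoMat` that fixes F under this action and, for
reduced F, is the matrix of a string. The ratio of its second column and its determinant are exactly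
the data of the continued fraction defining σ(f), so that string is σ(f) (`sigma_spec`). For
primitive f, minimality of the Pell solution makes σ(f) the shortest period: every nonempty string
fixing F begins with it (`sigma_prefix`). Hence the forms reached from F by strings come from the
proper prefixes of σ(f), are pairwise distinct, and number |σ(f)| (`encard_orbit`); moving among
them rotates σ(f).

Any matrix between equivalent reduced forms becomes, up to sign, a string matrix of the same
determinant after multiplication by a high power of an automorph (`exists_wact_eq`). Since the
determinant is (-1)^weight, proper equivalence means being joined by a string of even weight. If
σ(f) has odd weight, one extra turn repairs the parity and the orbit is a single class; if it has
even weight, parity is an invariant, the colours are well defined, and the orbit splits into two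
classes. Conversely, a string containing a 1, with matrix [α β; γ δ], fixes a unique primitive
reduced form, proportional to (γ, δ - α, -β) (`exists_form_of_word`, `eq_of_wact_eq`); if the string
is primitive, it is the σ of that form. -/

/-- Integral `2 × 2` matrices. -/
abbrev Mat2 : Type := Matrix (Fin 2) (Fin 2) ℤ

/-! ## The monoid generated by `[1 1; 0 1]` and `[0 1; 1 1]` -/

/-- The matrix of a bead. -/
def letterMat : Bool → Mat2
  | false => !![1, 1; 0, 1]
  | true => !![0, 1; 1, 1]

/-- The matrix of a binary string. -/
def wordMat (w : List Bool) : Mat2 := (w.map letterMat).prod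

@[simp] theorem wordMat_nil : wordMat [] = 1 := rfl

theorem wordMat_cons (x : Bool) (w : List Bool) : wordMat (x :: w) = letterMat x * wordMat w := by
  simp [wordMat]

theorem wordMat_append (v w : List Bool) : wordMat (v ++ w) = wordMat v * wordMat w := by
  simp [wordMat]

theorem wordMat_false_cons (w : List Bool) : wordMat (false :: w) =
    !![wordMat w 0 0 + wordMat w 1 0, wordMat w 0 1 + wordMat w 1 1;
      wordMat w 1 0, wordMat w 1 1] := by
  rw [wordMat_cons]
  ext i j; fin_cases i <;> fin_cases j <;> simp [letterMat, Matrix.mul_apply, Fin.sum_univ_two]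

theorem wordMat_true_cons (w : List Bool) : wordMat (true :: w) =
    !![wordMat w 1 0, wordMat w 1 1;
      wordMat w 0 0 + wordMat w 1 0, wordMat w 0 1 + wordMat w 1 1] := by
  rw [wordMat_cons]
  ext i j; fin_cases i <;> fin_cases j <;> simp [letterMat, Matrix.mul_apply, Fin.sum_univ_two]

theorem det_wordMat (w : List Bool) : (wordMat w).det = (-1) ^ w.count true := by
  induction w with
  | nil => simp
  | cons x w ih =>
    rw [wordMat_cons, Matrix.det_mul, ih]
    cases x <;> simp [letterMat, Matrix.det_fin_two, pow_succ]

theorem det_wordMat_sq (w : List Bool) : (wordMat w).det ^ 2 = 1 := by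
  rw [det_wordMat, ← pow_mul, mul_comm, pow_mul]; simp

theorem det_wordMat_eq_one {w : List Bool} : (wordMat w).det = 1 ↔ Even (w.count true) := by
  rw [det_wordMat, neg_one_pow_eq_one_iff_even (by norm_num)]

theorem wordMat_nonneg (w : List Bool) (i j : Fin 2) : 0 ≤ wordMat w i j := by
  induction w generalizing i j with
  | nil => fin_cases i <;> fin_cases j <;> simp
  | cons x w ih =>
    have := ih 0 0; have := ih 0 1; have := ih 1 0; have := ih 1 1
    cases x
    · rw [wordMat_false_cons]; fin_cases i <;> fin_cases j <;> simp <;> omega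
    · rw [wordMat_true_cons]; fin_cases i <;> fin_cases j <;> simp <;> omega

theorem wordMat_col_le {w : List Bool} (hw : w ≠ []) (i : Fin 2) :
    wordMat w i 0 ≤ wordMat w i 1 := by
  induction w generalizing i with
  | nil => exact absurd rfl hw
  | cons x w ih =>
    by_cases h : w = []
    · subst h
      cases x <;> fin_cases i <;> simp [wordMat_cons, letterMat]
    · have := ih h 0; have := ih h 1
      cases x
      · rw [wordMat_false_cons]; fin_cases i <;> simp <;> omega
      · rw [wordMat_true_cons]; fin_cases i <;> simp <;> omega

theorem wordMat_eq_one {w : List Bool} (h : wordMat w = 1) : w = [] := by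
  by_contra hw
  have := wordMat_col_le hw 0
  rw [h] at this
  simp at this

theorem mat2_det_sq {M : Mat2} (h : M.det ^ 2 = 1) : M.det = 1 ∨ M.det = -1 :=
  sq_eq_one_iff.mp h

/-- A matrix of determinant `±1` whose second column dominates its nonnegative first column
belongs to a nonempty string. -/
theorem exists_word_of_entries (n : ℕ) : ∀ a b c d : ℤ, a + b + c + d ≤ n → 0 ≤ a → a ≤ b → 0 ≤ c →
    c ≤ d → (a * d - b * c = 1 ∨ a * d - b * c = -1) →
    ∃ w : List Bool, w ≠ [] ∧ wordMat w = !![a, b; c, d] := by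
  induction n with
  | zero =>
    intro a b c d hn ha hab hc hcd hdet
    obtain rfl : a = 0 := by push_cast at hn; omega
    obtain rfl : b = 0 := by push_cast at hn; omega
    omega
  | succ n ih =>
    intro a b c d hn ha hab hc hcd hdet
    push_cast at hn
    have hd : 0 < d := by
      rcases (hc.trans hcd).lt_or_eq with h | h
      · exact h
      · obtain rfl : c = 0 := by omega
        subst h; simp at hdet
    have hb : 0 < b := by
      rcases (ha.trans hab).lt_or_eq with h | h
      · exact h
      · obtain rfl : a = 0 := by omega
        subst h; simp at hdet
    have hle : a * d - b * c ≤ 1 := by omega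
    have hge : -1 ≤ a * d - b * c := by omega
    -- Determinant ±1 forces one row to dominate the other. Subtracting the smaller row strips the
    -- first bead: 0 if the upper row dominates, 1 (with a swap) otherwise.
    by_cases hcmp : c ≤ a ∧ d ≤ b
    · obtain ⟨hca, hdb⟩ := hcmp
      by_cases h : a - c ≤ b - d
      · obtain ⟨w, -, hw⟩ := ih (a - c) (b - d) c d (by omega) (by omega) h hc hcd
          (by rcases hdet with h | h
              · left; linarith
              · right; linarith)
        exact ⟨false :: w, by simp, by rw [wordMat_false_cons, hw]; simp⟩
      -- The subtraction destroys the dominance of the second column only when the matrix is a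
      -- single bead.
      · push Not at h
        have h1 : (b - d) * (d - c) + d ≤ 1 := by
          nlinarith [mul_nonneg (sub_nonneg.mpr (Int.add_one_le_iff.mpr h)) hd.le]
        have h2 : 0 ≤ (b - d) * (d - c) := mul_nonneg (by omega) (by omega)
        obtain rfl : d = 1 := by omega
        have h3 : (b - 1) * (1 - c) = 0 := by omega
        rcases mul_eq_zero.mp h3 with h3 | h3
        · obtain rfl : b = 1 := by omega
          obtain rfl : c = 0 := by omega
          obtain rfl : a = 1 := by omega
          exact ⟨[false], by simp, by simp [wordMat_cons, letterMat]⟩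
        · omega
    · have hca : a ≤ c := by
        by_contra! h
        have h' : b < d := by
          by_contra! h'
          exact hcmp ⟨h.le, h'⟩
        nlinarith [mul_nonneg (sub_nonneg.mpr (Int.add_one_le_iff.mpr h)) hd.le,
          mul_nonneg hc (sub_nonneg.mpr (Int.add_one_le_iff.mpr h'))]
      have hbd : b ≤ d := by
        by_contra! h
        have h' : a < c := by
          by_contra! h'
          exact hcmp ⟨h', h.le⟩
        nlinarith [mul_nonneg (sub_nonneg.mpr (Int.add_one_le_iff.mpr h)) ha,
          mul_nonneg hb.le (sub_nonneg.mpr (Int.add_one_le_iff.mpr h'))]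
      by_cases h : c - a ≤ d - b
      · obtain ⟨w, -, hw⟩ := ih (c - a) (d - b) a b (by omega) (by omega) h ha hab
          (by rcases hdet with h | h
              · right; linarith
              · left; linarith)
        exact ⟨true :: w, by simp, by rw [wordMat_true_cons, hw]; simp⟩
      · push Not at h
        have h1 : (d - b) * (b - a) + b ≤ 1 := by
          nlinarith [mul_nonneg (sub_nonneg.mpr (Int.add_one_le_iff.mpr h)) hb.le]
        have h2 : 0 ≤ (d - b) * (b - a) := mul_nonneg (by omega) (by omega)
        obtain rfl : b = 1 := by omega
        have h3 : (d - 1) * (1 - a) = 0 := by omega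
        rcases mul_eq_zero.mp h3 with h3 | h3
        · obtain rfl : d = 1 := by omega
          obtain rfl : a = 0 := by omega
          obtain rfl : c = 1 := by omega
          exact ⟨[true], by simp, by simp [wordMat_cons, letterMat]⟩
        · omega

theorem exists_word {M : Mat2} (h0 : 0 ≤ M 0 0) (h1 : M 0 0 ≤ M 0 1) (h2 : 0 ≤ M 1 0)
    (h3 : M 1 0 ≤ M 1 1) (hM : M.det ^ 2 = 1) : ∃ w : List Bool, w ≠ [] ∧ wordMat w = M := by
  have := mat2_det_sq hM
  rw [Matrix.det_fin_two] at this
  obtain ⟨w, hw, h⟩ := exists_word_of_entries (M 0 0 + M 0 1 + M 1 0 + M 1 1).toNat _ _ _ _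
    (by omega) h0 h1 h2 h3 this
  exact ⟨w, hw, h.trans (Matrix.eta_fin_two M).symm⟩

/-! ## Continued fractions -/

theorem starsBars_surjective (w : List Bool) :
    ∃ q : List ℕ, (∀ a ∈ q, 0 < a) ∧ q ≠ [] ∧ starsBars q = w := by
  induction w with
  | nil => exact ⟨[1], by simp, by simp, by simp [starsBars]⟩
  | cons x w ih =>
    obtain ⟨q, hq, hne, rfl⟩ := ih
    obtain ⟨r, l, rfl⟩ := List.exists_cons_of_ne_nil hne
    cases x
    · have hr : 0 < r := hq r (by simp)
      refine ⟨(r + 1) :: l, ?_, by simp, ?_⟩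
      · intro a ha
        rcases List.mem_cons.mp ha with rfl | ha
        · omega
        · exact hq a (by simp [ha])
      · obtain ⟨r, rfl⟩ := Nat.exists_eq_succ_of_ne_zero hr.ne'
        cases l <;> simp [starsBars, List.replicate_succ]
    · refine ⟨1 :: r :: l, ?_, by simp, by simp [starsBars]⟩
      intro a ha
      rcases List.mem_cons.mp ha with rfl | ha
      · omega
      · exact hq a ha

theorem count_starsBars {q : List ℕ} (hq : q ≠ []) : (starsBars q).count true + 1 = q.length := by
  induction q with
  | nil => exact absurd rfl hq
  | cons a l ih =>
    cases l with
    | nil => simp [starsBars, List.count_replicate]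
    | cons r l => simp [starsBars, List.count_replicate, ← ih]

theorem wordMat_replicate_false_append (k : ℕ) (w : List Bool) (j : Fin 2) :
    wordMat (List.replicate k false ++ w) 0 j = wordMat w 0 j + k * wordMat w 1 j ∧
    wordMat (List.replicate k false ++ w) 1 j = wordMat w 1 j := by
  induction k with
  | zero => simp
  | succ k ih =>
    rw [List.replicate_succ, List.cons_append, wordMat_false_cons]
    fin_cases j
    · simp at ih ⊢; rw [ih.1, ih.2]; constructor <;> ring
    · simp at ih ⊢; rw [ih.1, ih.2]; constructor <;> ring

theorem wordMat_one_one_pos (w : List Bool) : 0 < wordMat w 1 1 := by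
  by_cases hw : w = []
  · simp [hw]
  · have h0 := wordMat_nonneg w 1 0
    have h1 := wordMat_col_le hw 1
    rcases (h0.trans h1).lt_or_eq with h | h
    · exact h
    · have := det_wordMat_sq w
      rw [Matrix.det_fin_two, ← h, show wordMat w 1 0 = 0 by omega] at this
      simp at this

/-- A block 0^k 1 has matrix [1 k; 0 1][0 1; 1 1], which is one step of the Euclidean algorithm; the
summand 1 absorbs the shift from q to q - 1. -/
theorem cfValue_eq {q : List ℕ} (hq : ∀ a ∈ q, 0 < a) (hne : q ≠ []) :
    cfValue q = 1 + (wordMat (starsBars q) 0 1 : ℚ) / wordMat (starsBars q) 1 1 := by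
  induction q with
  | nil => exact absurd rfl hne
  | cons a l ih =>
    have ha : 0 < a := hq a (by simp)
    obtain ⟨k, rfl⟩ := Nat.exists_eq_succ_of_ne_zero ha.ne'
    cases l with
    | nil =>
      have := wordMat_replicate_false_append k [] 1
      simp at this
      simp [cfValue, starsBars, this.1, this.2]; ring
    | cons r l =>
      have ih' := ih (fun a ha => hq a (by simp [ha])) (by simp)
      simp only [cfValue] 
      rw [ih']
      simp only [starsBars, Nat.succ_eq_add_one, Nat.add_sub_cancel]
      set W := wordMat (starsBars (r :: l)) with hW
      have h := wordMat_replicate_false_append k (true :: starsBars (r :: l)) 1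
      rw [h.1, h.2, wordMat_true_cons, ← hW]
      have h1 : (0 : ℚ) < W 1 1 := by exact_mod_cast wordMat_one_one_pos _
      have h2 : (0 : ℚ) ≤ W 0 1 := by exact_mod_cast wordMat_nonneg _ _ _
      have h3 : (W 0 1 : ℚ) + W 1 1 ≠ 0 := by positivity
      have h4 : (W 1 1 : ℚ) + W 0 1 ≠ 0 := by positivity
      simp
      field_simp
      ring

/-- A matrix of determinant `±1` whose second column dominates its nonnegative first column is
determined by the ratio of the entries of the second column and the determinant. -/
theorem mat2_eq_of_ratio {M N : Mat2} (hM : M.det ^ 2 = 1) (hdet : M.det = N.det)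
    (hM0 : 0 ≤ M 0 0) (hN0 : 0 ≤ N 0 0) (hMpos : 0 < M 0 1) (hM1 : 0 < M 1 1) (hN1 : 0 < N 1 1)
    (hM00 : M 0 0 ≤ M 0 1) (hN00 : N 0 0 ≤ N 0 1)
    (hM2 : 0 ≤ M 1 0) (hN2 : 0 ≤ N 1 0) (hM10 : M 1 0 ≤ M 1 1) (hN10 : N 1 0 ≤ N 1 1)
    (h : M 0 1 * N 1 1 = N 0 1 * M 1 1) : M = N := by
  have hN : N.det ^ 2 = 1 := hdet ▸ hM
  have e1 : M 1 1 = N 1 1 := by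
    apply Int.dvd_antisymm hM1.le hN1.le
    · have : M 1 1 ∣ M.det ^ 2 * N 1 1 := by
        rw [Matrix.det_fin_two]
        refine ⟨(M 0 0 * M 1 1 - M 0 1 * M 1 0) * M 0 0 * N 1 1
          - (M 0 0 * M 1 1 - M 0 1 * M 1 0) * M 1 0 * N 0 1, ?_⟩
        linear_combination (-(M 0 0 * M 1 1 - M 0 1 * M 1 0) * M 1 0) * h
      rwa [hM, one_mul] at this
    · have : N 1 1 ∣ N.det ^ 2 * M 1 1 := by
        rw [Matrix.det_fin_two]
        refine ⟨(N 0 0 * N 1 1 - N 0 1 * N 1 0) * N 0 0 * M 1 1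
          - (N 0 0 * N 1 1 - N 0 1 * N 1 0) * N 1 0 * M 0 1, ?_⟩
        linear_combination ((N 0 0 * N 1 1 - N 0 1 * N 1 0) * N 1 0) * h
      rwa [hN, one_mul] at this
  have e2 : M 0 1 = N 0 1 := by
    rw [e1] at h
    exact mul_right_cancel₀ hN1.ne' h
  -- The second columns agree, being primitive vectors on the same ray. Equal determinants then make
  -- the first columns differ by k times the second, and the bounds on the entries leave only k = 0.
  have key : (M 0 0 - N 0 0) * M 1 1 = M 0 1 * (M 1 0 - N 1 0) := by
    have := hdet
    rw [Matrix.det_fin_two, Matrix.det_fin_two, ← e1, ← e2] at this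
    linear_combination this
  have hdvd : M 1 1 ∣ M 1 0 - N 1 0 := by
    have : M 1 1 ∣ M.det ^ 2 * (M 1 0 - N 1 0) := by
      rw [Matrix.det_fin_two]
      refine ⟨(M 0 0 * M 1 1 - M 0 1 * M 1 0) * (M 0 0 * (M 1 0 - N 1 0)
        - M 1 0 * (M 0 0 - N 0 0)), ?_⟩
      linear_combination ((M 0 0 * M 1 1 - M 0 1 * M 1 0) * M 1 0) * key
    rwa [hM, one_mul] at this
  obtain ⟨k, hk⟩ := hdvd
  have hk' : M 0 0 - N 0 0 = M 0 1 * k := by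
    rw [hk] at key
    have : (M 0 0 - N 0 0) * M 1 1 = (M 0 1 * k) * M 1 1 := by rw [key]; ring
    exact mul_right_cancel₀ hM1.ne' this
  have nd : ∀ P : Mat2, P.det ^ 2 = 1 → P 0 0 = 0 → P 1 0 = 0 → False := by
    intro P hP h1 h2
    rw [Matrix.det_fin_two, h1, h2] at hP
    simp at hP
  have k1 : k < 1 := by
    by_contra! hk1
    have a1 : M 0 1 * 1 ≤ M 0 1 * k := by gcongr
    have a2 : M 1 1 * 1 ≤ M 1 1 * k := by gcongr
    exact nd N hN (by omega) (by omega)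
  have k2 : -1 < k := by
    by_contra! hk1
    have a1 : M 0 1 * k ≤ M 0 1 * (-1) := by gcongr
    have a2 : M 1 1 * k ≤ M 1 1 * (-1) := by gcongr
    exact nd M hM (by omega) (by omega)
  obtain rfl : k = 0 := by omega
  ext i j
  fin_cases i <;> fin_cases j <;> simp <;> omega

/-! ## The twisted action of `GL₂(ℤ)` -/

namespace BQF

/-- The form `det M • (f ∘ M)`. -/
def tact (f : BQF) (M : Mat2) : BQF where
  A := M.det * (f.A * M 0 0 ^ 2 + f.B * M 0 0 * M 1 0 + f.C * M 1 0 ^ 2)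
  B := M.det * (2 * f.A * M 0 0 * M 0 1 + f.B * (M 0 0 * M 1 1 + M 0 1 * M 1 0)
    + 2 * f.C * M 1 0 * M 1 1)
  C := M.det * (f.A * M 0 1 ^ 2 + f.B * M 0 1 * M 1 1 + f.C * M 1 1 ^ 2)

@[simp] theorem tact_one (f : BQF) : f.tact 1 = f := by
  ext <;> simp [tact]

theorem tact_mul (f : BQF) (M N : Mat2) : f.tact (M * N) = (f.tact M).tact N := by
  ext <;> simp only [tact, Matrix.det_mul, Matrix.mul_apply, Fin.sum_univ_two] <;> ring

theorem tact_neg (f : BQF) (M : Mat2) : f.tact (-M) = f.tact M := by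
  ext <;> simp [tact, Matrix.det_neg]

theorem tact_tact_adjugate (f : BQF) {M : Mat2} (hM : M.det ^ 2 = 1) :
    (f.tact M).tact M.adjugate = f := by
  rw [← tact_mul, Matrix.mul_adjugate]
  rcases mat2_det_sq hM with h | h
  · simp [h]
  · rw [h]; simp [tact_neg]

theorem disc_tact (f : BQF) {M : Mat2} (hM : M.det ^ 2 = 1) : (f.tact M).disc = f.disc := by
  have : (f.tact M).disc = (M.det ^ 2) ^ 2 * f.disc := by
    simp only [tact, disc, Matrix.det_fin_two]; ring
  rw [this, hM]; ring

theorem tact_eq_act (f : BQF) (M : Matrix.SpecialLinearGroup (Fin 2) ℤ) :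
    f.tact M = f.act M := by
  ext <;> simp [tact, act]

/-- The coefficients generate the unit ideal. -/
def IsUnimodular (f : BQF) : Prop := ∃ x y z : ℤ, x * f.A + y * f.B + z * f.C = 1

theorem isPrimitive_iff (f : BQF) : f.IsPrimitive ↔ f.IsUnimodular := by
  constructor
  · intro h
    have h1 := Int.gcd_eq_gcd_ab (Int.gcd f.A f.B) f.C
    have h2 := Int.gcd_eq_gcd_ab f.A f.B
    rw [show Int.gcd (Int.gcd f.A f.B) f.C = 1 from h, h2] at h1
    generalize Int.gcdB (f.A * Int.gcdA f.A f.B + f.B * Int.gcdB f.A f.B) f.C = l at h1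
    generalize Int.gcdA (f.A * Int.gcdA f.A f.B + f.B * Int.gcdB f.A f.B) f.C = k at h1
    push_cast at h1
    exact ⟨Int.gcdA f.A f.B * k, Int.gcdB f.A f.B * k, l, by linear_combination -h1⟩
  · rintro ⟨x, y, z, h⟩
    have hd : ((Int.gcd (Int.gcd f.A f.B) f.C : ℕ) : ℤ) ∣ 1 := by
      rw [← h]
      have h1 := Int.gcd_dvd_left (Int.gcd f.A f.B : ℤ) f.C
      have h2 := Int.gcd_dvd_right (Int.gcd f.A f.B : ℤ) f.C
      have h3 := h1.trans (Int.gcd_dvd_left f.A f.B)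
      have h4 := h1.trans (Int.gcd_dvd_right f.A f.B)
      exact dvd_add (dvd_add (h3.mul_left x) (h4.mul_left y)) (h2.mul_left z)
    have := Int.natCast_dvd_natCast.mp (by simpa using hd : ((Int.gcd (Int.gcd f.A f.B) f.C : ℕ) : ℤ) ∣ ((1 : ℕ) : ℤ))
    exact Nat.dvd_one.mp this

theorem IsUnimodular.of_tact {f : BQF} {M : Mat2} (h : (f.tact M).IsUnimodular) :
    f.IsUnimodular := by
  obtain ⟨x, y, z, h⟩ := h
  simp only [tact] at h
  refine ⟨M.det * (x * M 0 0 ^ 2 + y * (2 * M 0 0 * M 0 1) + z * M 0 1 ^ 2),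
    M.det * (x * (M 0 0 * M 1 0) + y * (M 0 0 * M 1 1 + M 0 1 * M 1 0) + z * (M 0 1 * M 1 1)),
    M.det * (x * M 1 0 ^ 2 + y * (2 * M 1 0 * M 1 1) + z * M 1 1 ^ 2), ?_⟩
  linear_combination h

theorem IsUnimodular.tact {f : BQF} {M : Mat2} (hM : M.det ^ 2 = 1) (h : f.IsUnimodular) :
    (f.tact M).IsUnimodular := by
  rw [← f.tact_tact_adjugate hM] at h
  exact h.of_tact

/-- Positive at `(1, 0)`, negative at `(0, 1)` and at `(1, -1)`. -/
def IsReduced (f : BQF) : Prop := 0 < f.A ∧ f.C < 0 ∧ f.A + f.C < f.B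

/-- The discriminant is positive and not a square. -/
def IsIndef (f : BQF) : Prop := 0 < f.disc ∧ ¬ IsSquare f.disc

theorem IsIndef.eval_ne_zero {f : BQF} (hf : f.IsIndef) {x y : ℤ} (h : x ≠ 0 ∨ y ≠ 0) :
    f.eval x y ≠ 0 := by
  intro h0
  rw [eval] at h0
  -- Completing the square: a nontrivial zero would make the discriminant a square.
  have key : f.disc * y ^ 2 = (2 * f.A * x + f.B * y) ^ 2 := by
    rw [disc]; linear_combination (-4 * f.A) * h0
  have key' : f.disc * x ^ 2 = (2 * f.C * y + f.B * x) ^ 2 := by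
    rw [disc]; linear_combination (-4 * f.C) * h0
  have aux : ∀ a b : ℤ, a ≠ 0 → f.disc * a ^ 2 = b ^ 2 → False := by
    intro a b ha hab
    obtain ⟨k, rfl⟩ : a ∣ b := (Int.pow_dvd_pow_iff two_ne_zero).mp ⟨f.disc, by linarith⟩
    refine hf.2 ⟨k, ?_⟩
    have : f.disc * a ^ 2 = (k * k) * a ^ 2 := by rw [hab]; ring
    exact mul_right_cancel₀ (pow_ne_zero 2 ha) this
  rcases h with h | h
  · exact aux _ _ h key'
  · exact aux _ _ h key

theorem IsIndef.tact {f : BQF} (hf : f.IsIndef) {M : Mat2} (hM : M.det ^ 2 = 1) :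
    (f.tact M).IsIndef := by
  unfold IsIndef; rw [disc_tact f hM]; exact hf

/-! ### Strings acting on reduced forms -/

/-- The action of a string. -/
def wact (f : BQF) (w : List Bool) : BQF := f.tact (wordMat w)

@[simp] theorem wact_nil (f : BQF) : f.wact [] = f := by simp [wact]

theorem wact_append (f : BQF) (v w : List Bool) : f.wact (v ++ w) = (f.wact v).wact w := by
  rw [wact, wordMat_append, tact_mul]; rfl

theorem wact_cons (f : BQF) (x : Bool) (w : List Bool) :
    f.wact (x :: w) = (f.wact [x]).wact w := f.wact_append [x] w

theorem IsIndef.wact {f : BQF} (hf : f.IsIndef) (w : List Bool) : (f.wact w).IsIndef :=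
  hf.tact (det_wordMat_sq w)

theorem wact_false (f : BQF) : f.wact [false] = ⟨f.A, 2 * f.A + f.B, f.A + f.B + f.C⟩ := by
  ext <;> simp [wact, wordMat_cons, letterMat, tact, Matrix.det_fin_two]

theorem wact_true (f : BQF) :
    f.wact [true] = ⟨-f.C, -f.B - 2 * f.C, -(f.A + f.B + f.C)⟩ := by
  ext <;> simp [wact, wordMat_cons, letterMat, tact, Matrix.det_fin_two]; ring

theorem IsReduced.wact_false_iff {f : BQF} (hf : f.IsReduced) :
    (f.wact [false]).IsReduced ↔ f.A + f.B + f.C < 0 := by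
  obtain ⟨h1, h2, h3⟩ := hf
  rw [wact_false]
  simp only [IsReduced]; omega

theorem IsReduced.wact_true_iff {f : BQF} (hf : f.IsReduced) :
    (f.wact [true]).IsReduced ↔ 0 < f.A + f.B + f.C := by
  obtain ⟨h1, h2, h3⟩ := hf
  rw [wact_true]
  simp only [IsReduced]; omega

theorem not_isReduced_wact_of_nonneg {f : BQF} (hA : 0 ≤ f.A) (hB : 0 ≤ f.B) (hC : 0 ≤ f.C)
    (w : List Bool) : ¬ (f.wact w).IsReduced := by
  rintro ⟨h1, h2, -⟩
  have n00 := wordMat_nonneg w 0 0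
  have n01 := wordMat_nonneg w 0 1
  have n10 := wordMat_nonneg w 1 0
  have n11 := wordMat_nonneg w 1 1
  simp only [wact, tact] at h1 h2
  have e1 : 0 ≤ f.A * wordMat w 0 0 ^ 2 + f.B * wordMat w 0 0 * wordMat w 1 0
    + f.C * wordMat w 1 0 ^ 2 := by positivity
  have e2 : 0 ≤ f.A * wordMat w 0 1 ^ 2 + f.B * wordMat w 0 1 * wordMat w 1 1
    + f.C * wordMat w 1 1 ^ 2 := by positivity
  have d1 := pos_of_mul_pos_left h1 e1
  exact absurd (mul_nonneg d1.le e2) (not_le.mpr h2)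

/-- The wrong bead yields a form with nonnegative coefficients, and no string makes such a form
reduced again (`not_isReduced_wact_of_nonneg`). -/
theorem IsReduced.wact_head {f : BQF} (hf : f.IsReduced) (hi : f.IsIndef) {x : Bool}
    {w : List Bool} (h : (f.wact (x :: w)).IsReduced) : (f.wact [x]).IsReduced := by
  have h0 := hi.eval_ne_zero (x := 1) (y := 1) (by simp)
  simp only [eval] at h0
  obtain ⟨h1, h2, h3⟩ := hf
  rw [wact_cons] at h
  cases x
  · rw [IsReduced.wact_false_iff ⟨h1, h2, h3⟩]
    by_contra! hc
    rw [wact_false] at h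
    exact not_isReduced_wact_of_nonneg (f := ⟨f.A, 2 * f.A + f.B, f.A + f.B + f.C⟩) h1.le
      (by simp only; omega) hc w h
  · rw [IsReduced.wact_true_iff ⟨h1, h2, h3⟩]
    by_contra! hc
    rw [wact_true] at h
    exact not_isReduced_wact_of_nonneg (f := ⟨_, _, _⟩) (by simp only; omega)
      (by simp only; omega) (by simp only; omega) w h

theorem IsReduced.letter_unique {f : BQF} (hf : f.IsReduced) {x y : Bool}
    (hx : (f.wact [x]).IsReduced) (hy : (f.wact [y]).IsReduced) : x = y := by
  cases x <;> cases y <;> simp only [hf.wact_false_iff, hf.wact_true_iff] at hx hy <;>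
    first | rfl | omega

/-- Strings keeping a form reduced are comparable. -/
theorem IsReduced.prefix_of_length_le {f : BQF} (hf : f.IsReduced) (hi : f.IsIndef)
    {v w : List Bool} (hv : (f.wact v).IsReduced) (hw : (f.wact w).IsReduced)
    (hl : v.length ≤ w.length) : v <+: w := by
  induction v generalizing f w with
  | nil => exact List.nil_prefix
  | cons x v ih =>
    cases w with
    | nil => simp at hl
    | cons y w =>
      have hx := hf.wact_head hi hv
      have hy := hf.wact_head hi hw
      obtain rfl := hf.letter_unique hx hy
      rw [List.prefix_cons_inj]
      rw [wact_cons] at hv hw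
      exact ih hx (hi.wact _) hv hw (by simpa using hl)

theorem IsReduced.wact_take {f : BQF} (hf : f.IsReduced) (hi : f.IsIndef) {v w : List Bool}
    (h : (f.wact (v ++ w)).IsReduced) : (f.wact v).IsReduced := by
  induction v generalizing f with
  | nil => simpa using hf
  | cons x v ih =>
    have hx := hf.wact_head hi h
    rw [wact_cons]
    rw [List.cons_append, wact_cons] at h
    exact ih hx (hi.wact _) h

theorem IsReduced.eq_of_length_eq {f : BQF} (hf : f.IsReduced) (hi : f.IsIndef)
    {v w : List Bool} (hv : (f.wact v).IsReduced) (hw : (f.wact w).IsReduced)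
    (hl : v.length = w.length) : v = w :=
  (hf.prefix_of_length_le hi hv hw hl.le).eq_of_length hl

/-! ### Connecting equivalent reduced forms -/

/-- Both coordinates have the same weak sign. -/
def SameSign (x y : ℤ) : Prop := (0 ≤ x ∧ 0 ≤ y) ∨ (x ≤ 0 ∧ y ≤ 0)

/-- Both beads replace one coordinate by the sum. Coordinates of strictly opposite signs then either
acquire a common weak sign, which persists, or lose at least 1 in total absolute value. -/
theorem sameSign_or_le (w : List Bool) (x y : ℤ) :
    SameSign (wordMat w 0 0 * x + wordMat w 0 1 * y) (wordMat w 1 0 * x + wordMat w 1 1 * y) ∨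
    (wordMat w 0 0 * x + wordMat w 0 1 * y).natAbs
      + (wordMat w 1 0 * x + wordMat w 1 1 * y).natAbs + w.length ≤ x.natAbs + y.natAbs := by
  induction w with
  | nil => right; simp
  | cons l w ih =>
    set p := wordMat w 0 0 * x + wordMat w 0 1 * y with hp
    set q := wordMat w 1 0 * x + wordMat w 1 1 * y with hq
    cases l
    · have e0 : wordMat (false :: w) 0 0 * x + wordMat (false :: w) 0 1 * y = p + q := by
        rw [wordMat_false_cons]; simp [hp, hq]; ring
      have e1 : wordMat (false :: w) 1 0 * x + wordMat (false :: w) 1 1 * y = q := by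
        rw [wordMat_false_cons]; simp [hq]
      rw [e0, e1, List.length_cons]
      simp only [SameSign] at ih ⊢
      omega
    · have e0 : wordMat (true :: w) 0 0 * x + wordMat (true :: w) 0 1 * y = q := by
        rw [wordMat_true_cons]; simp [hq]
      have e1 : wordMat (true :: w) 1 0 * x + wordMat (true :: w) 1 1 * y = p + q := by
        rw [wordMat_true_cons]; simp [hp, hq]; ring
      rw [e0, e1, List.length_cons]
      simp only [SameSign] at ih ⊢
      omega

/-- A long enough string carries a given vector into the positive or the negative quadrant. -/
theorem sameSign_of_length (w : List Bool) {x y : ℤ} (h : x.natAbs + y.natAbs ≤ w.length) :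
    SameSign (wordMat w 0 0 * x + wordMat w 0 1 * y) (wordMat w 1 0 * x + wordMat w 1 1 * y) := by
  rcases sameSign_or_le w x y with h' | h'
  · exact h'
  · simp only [SameSign]; omega

theorem eval_neg_neg (f : BQF) (x y : ℤ) : f.eval (-x) (-y) = f.eval x y := by
  simp only [eval]; ring

/-- In the positive quadrant, positive values are taken to the right of negative ones. -/
theorem IsReduced.det_pos {f : BQF} (hf : f.IsReduced) {p q r s : ℤ} (hp : 0 ≤ p) (hq : 0 ≤ q)
    (hr : 0 ≤ r) (hs : 0 ≤ s) (h1 : 0 < f.eval p r) (h2 : f.eval q s < 0) : 0 < p * s - q * r := by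
  obtain ⟨hA, hC, -⟩ := hf
  have key : f.eval p r * (q * s) + (-f.eval q s) * (p * r) =
      (f.A * (p * q) + (-f.C) * (r * s)) * (p * s - q * r) := by
    simp only [eval]; ring
  have hs' : 0 < s := by
    rcases hs.lt_or_eq with h | rfl
    · exact h
    · simp only [eval] at h2; nlinarith [mul_nonneg hA.le (sq_nonneg q)]
  have hp' : 0 < p := by
    rcases hp.lt_or_eq with h | rfl
    · exact h
    · simp only [eval] at h1; nlinarith [mul_nonneg (neg_nonneg.mpr hC.le) (sq_nonneg r)]
  rcases hq.lt_or_eq with hq' | rfl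
  · have h3 : 0 < f.eval p r * (q * s) := by positivity
    have h4 : 0 ≤ (-f.eval q s) * (p * r) := mul_nonneg (by omega) (by positivity)
    have hC' : 0 ≤ -f.C := by omega
    exact pos_of_mul_pos_right (by rw [← key]; omega) (by positivity)
  · have : 0 < p * s := by positivity
    linarith

/-- Reducedness of the new form prescribes the signs of f at the two columns and at their
difference. If the second column or the difference lay in the negative quadrant, negating it would
contradict the orientation given by `det_pos`. -/
theorem IsReduced.tact_sameSign {f : BQF} (hf : f.IsReduced) {M : Mat2} (hM : M.det ^ 2 = 1)
    (hg : (f.tact M).IsReduced) (h0 : 0 ≤ M 0 0) (h1 : 0 ≤ M 1 0)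
    (hs : SameSign (M 0 1) (M 1 1)) (hd : SameSign (M 0 1 - M 0 0) (M 1 1 - M 1 0)) :
    M 0 0 ≤ M 0 1 ∧ M 1 0 ≤ M 1 1 := by
  obtain ⟨g1, g2, g3⟩ := hg
  have e1 : (f.tact M).A = M.det * f.eval (M 0 0) (M 1 0) := by simp only [tact, eval]
  have e2 : (f.tact M).C = M.det * f.eval (M 0 1) (M 1 1) := by simp only [tact, eval]
  have e3 : (f.tact M).A + (f.tact M).C - (f.tact M).B
      = M.det * f.eval (M 0 1 - M 0 0) (M 1 1 - M 1 0) := by simp only [tact, eval]; ring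
  have g3' : (f.tact M).A + (f.tact M).C - (f.tact M).B < 0 := by omega
  rw [e1] at g1; rw [e2] at g2; rw [e3] at g3'
  have hdet := Matrix.det_fin_two M
  have hcases := mat2_det_sq hM
  have hs' : 0 ≤ M 0 1 ∧ 0 ≤ M 1 1 := by
    rcases hs with hs | ⟨ha, hb⟩
    · exact hs
    · exfalso
      rw [← f.eval_neg_neg] at g2
      rcases hcases with h | h
      · rw [h] at g1 g2
        have := hf.det_pos h0 (neg_nonneg.mpr ha) h1 (neg_nonneg.mpr hb) (by linarith)
          (by linarith)
        rw [h] at hdet; linarith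
      · rw [h] at g1 g2
        have := hf.det_pos (neg_nonneg.mpr ha) h0 (neg_nonneg.mpr hb) h1 (by linarith)
          (by linarith)
        rw [h] at hdet; linarith
  rcases hd with ⟨ha, hb⟩ | ⟨ha, hb⟩
  · omega
  · exfalso
    rw [← f.eval_neg_neg] at g3'
    rcases hcases with h | h
    · rw [h] at g1 g3'
      have := hf.det_pos h0 (neg_nonneg.mpr ha) h1 (neg_nonneg.mpr hb) (by linarith)
        (by linarith)
      rw [h] at hdet; linarith
    · rw [h] at g1 g3'
      have := hf.det_pos (neg_nonneg.mpr ha) h0 (neg_nonneg.mpr hb) h1 (by linarith)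
        (by linarith)
      rw [h] at hdet; linarith

theorem wact_flatten_replicate {f : BQF} {v : List Bool} (h : f.wact v = f) (k : ℕ) :
    f.wact (List.replicate k v).flatten = f := by
  induction k with
  | zero => simp
  | succ k ih => rw [List.replicate_succ, List.flatten_cons, wact_append, h, ih]

/-- Premultiplying M by many copies of v does not change the resulting form, but carries both
columns and their difference into the positive or negative quadrant; then M or -M satisfies the
conditions of `exists_word`. -/
theorem IsReduced.exists_wact_eq {f : BQF} (hf : f.IsReduced) {v : List Bool} (hv : v ≠ [])
    (hfv : f.wact v = f) {M : Mat2} (hM : M.det ^ 2 = 1) (hg : (f.tact M).IsReduced) :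
    ∃ w : List Bool, f.wact w = f.tact M ∧ (wordMat w).det = M.det := by
  obtain ⟨n, hn⟩ : ∃ n : ℕ, (M 0 0).natAbs + (M 1 0).natAbs ≤ n ∧
      (M 0 1).natAbs + (M 1 1).natAbs ≤ n ∧
      (M 0 1 - M 0 0).natAbs + (M 1 1 - M 1 0).natAbs ≤ n :=
    ⟨(M 0 0).natAbs + (M 1 0).natAbs + ((M 0 1).natAbs + (M 1 1).natAbs)
      + ((M 0 1 - M 0 0).natAbs + (M 1 1 - M 1 0).natAbs), by omega⟩
  -- The factor 2 makes the weight of u even, so that the determinant of M is preserved.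
  set u := (List.replicate (2 * n) v).flatten with hu
  have hfu : f.wact u = f := wact_flatten_replicate hfv _
  have hlen : n ≤ u.length := by
    have : 0 < v.length := List.length_pos_iff.mpr hv
    simp only [hu, List.length_flatten, List.map_replicate, List.sum_replicate, smul_eq_mul]
    nlinarith
  have hdet : (wordMat u).det = 1 := by
    rw [det_wordMat_eq_one, hu, List.count_flatten]
    simp [mul_assoc]
  set N := wordMat u * M with hN
  have hNdet : N.det = M.det := by rw [hN, Matrix.det_mul, hdet, one_mul]
  have hfN : f.tact N = f.tact M := by
    rw [hN, tact_mul]; congr 1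
  have n00 : N 0 0 = wordMat u 0 0 * M 0 0 + wordMat u 0 1 * M 1 0 := by
    simp [hN, Matrix.mul_apply, Fin.sum_univ_two]
  have n01 : N 0 1 = wordMat u 0 0 * M 0 1 + wordMat u 0 1 * M 1 1 := by
    simp [hN, Matrix.mul_apply, Fin.sum_univ_two]
  have n10 : N 1 0 = wordMat u 1 0 * M 0 0 + wordMat u 1 1 * M 1 0 := by
    simp [hN, Matrix.mul_apply, Fin.sum_univ_two]
  have n11 : N 1 1 = wordMat u 1 0 * M 0 1 + wordMat u 1 1 * M 1 1 := by
    simp [hN, Matrix.mul_apply, Fin.sum_univ_two]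
  have s1 : SameSign (N 0 0) (N 1 0) := by
    rw [n00, n10]; exact sameSign_of_length u (by omega)
  have s2 : SameSign (N 0 1) (N 1 1) := by
    rw [n01, n11]; exact sameSign_of_length u (by omega)
  have s3 : SameSign (N 0 1 - N 0 0) (N 1 1 - N 1 0) := by
    have := sameSign_of_length u (x := M 0 1 - M 0 0) (y := M 1 1 - M 1 0) (by omega)
    rw [n00, n01, n10, n11]
    convert this using 1 <;> ring
  rw [← hNdet] at hM
  rw [← hfN] at hg
  rw [← hfN, ← hNdet]
  rcases s1 with ⟨a, b⟩ | ⟨a, b⟩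
  · obtain ⟨c, d⟩ := hf.tact_sameSign hM hg a b s2 s3
    obtain ⟨w, -, hw⟩ := exists_word a c b d hM
    exact ⟨w, by rw [wact, hw], by rw [hw]⟩
  · have hM' : (-N).det ^ 2 = 1 := by rw [Matrix.det_neg]; simpa using hM
    have a' : 0 ≤ (-N) 0 0 := by simpa using a
    have b' : 0 ≤ (-N) 1 0 := by simpa using b
    obtain ⟨c, d⟩ := hf.tact_sameSign hM' (by rwa [tact_neg]) a' b'
      (by simp only [SameSign, Matrix.neg_apply] at s2 ⊢; omega)
      (by simp only [SameSign, Matrix.neg_apply] at s3 ⊢; omega)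
    obtain ⟨w, -, hw⟩ := exists_word a' c b' d hM'
    exact ⟨w, by rw [wact, hw, tact_neg], by rw [hw, Matrix.det_neg]; simp⟩

end BQF

/-! ## The fundamental automorph -/

theorem isPellSol_pell {D : ℤ} (h0 : 0 < D) (hD : ¬ IsSquare D) :
    IsPellSol D (pellT D) (pellU D) := by
  have h1 : {u : ℕ | ∃ t : ℕ, IsPellSol D t u}.Nonempty := by
    obtain ⟨x, y, h, hy⟩ := Pell.exists_of_not_isSquare h0 hD
    have hx : x ≠ 0 := by
      rintro rfl
      nlinarith [mul_nonneg h0.le (sq_nonneg y)]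
    refine ⟨2 * y.natAbs, 2 * x.natAbs, by positivity, by positivity, ?_⟩
    push_cast
    rw [mul_pow, mul_pow, sq_abs, sq_abs, show 2 ^ 2 * x ^ 2 - D * (2 ^ 2 * y ^ 2)
      = 4 * (x ^ 2 - D * y ^ 2) by ring, h]
    norm_num
  exact Nat.sInf_mem (s := {t : ℕ | IsPellSol D t (pellU D)}) (Nat.sInf_mem h1)

theorem pellU_le {D : ℤ} {t u : ℕ} (h : IsPellSol D t u) : pellU D ≤ u :=
  Nat.sInf_le ⟨t, h⟩

theorem pellT_le {D : ℤ} {t : ℕ} (h : IsPellSol D t (pellU D)) : pellT D ≤ t :=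
  Nat.sInf_le h

theorem IsPellSol.cases {D : ℤ} {t u : ℕ} (h : IsPellSol D t u) :
    (t : ℤ) ^ 2 - D * (u : ℤ) ^ 2 = 4 ∨ (t : ℤ) ^ 2 - D * (u : ℤ) ^ 2 = -4 :=
  (abs_eq (by norm_num)).mp h.2.2

namespace BQF

theorem two_dvd_of_isPellSol {f : BQF} {t u : ℕ} (h : IsPellSol f.disc t u) :
    (2 : ℤ) ∣ t - f.B * u ∧ (2 : ℤ) ∣ t + f.B * u := by
  have key : (2 : ℤ) ∣ (t + f.B * u) * (t - f.B * u) := by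
    rcases h.cases with h | h
    · exact ⟨2 - 2 * f.A * f.C * u ^ 2, by simp only [disc] at h; linear_combination h⟩
    · exact ⟨-2 - 2 * f.A * f.C * u ^ 2, by simp only [disc] at h; linear_combination h⟩
  rcases Int.prime_two.dvd_or_dvd key with h' | h' <;> omega

/-- The matrix of the fundamental solution, which fixes the form up to sign. -/
noncomputable def autoMat (f : BQF) : Mat2 :=
  !![(pellT f.disc - f.B * pellU f.disc) / 2, -f.C * pellU f.disc;
    f.A * pellU f.disc, (pellT f.disc + f.B * pellU f.disc) / 2]

theorem two_mul_autoMat {f : BQF} (hf : f.IsIndef) :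
    2 * f.autoMat 0 0 = pellT f.disc - f.B * pellU f.disc ∧
    2 * f.autoMat 1 1 = pellT f.disc + f.B * pellU f.disc ∧
    f.autoMat 0 1 = -f.C * pellU f.disc ∧ f.autoMat 1 0 = f.A * pellU f.disc := by
  obtain ⟨h1, h2⟩ := two_dvd_of_isPellSol (isPellSol_pell hf.1 hf.2)
  exact ⟨Int.mul_ediv_cancel' h1, Int.mul_ediv_cancel' h2, rfl, rfl⟩

theorem four_mul_det_autoMat {f : BQF} (hf : f.IsIndef) :
    4 * f.autoMat.det = (pellT f.disc : ℤ) ^ 2 - f.disc * (pellU f.disc : ℤ) ^ 2 := by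
  obtain ⟨h1, h2, h3, h4⟩ := two_mul_autoMat hf
  have : 4 * f.autoMat.det = 2 * f.autoMat 0 0 * (2 * f.autoMat 1 1)
    - 4 * (f.autoMat 0 1 * f.autoMat 1 0) := by rw [Matrix.det_fin_two]; ring
  rw [this, h1, h2, h3, h4]
  generalize pellT f.disc = t
  generalize pellU f.disc = u
  simp only [disc]; ring

theorem det_autoMat_sq {f : BQF} (hf : f.IsIndef) : f.autoMat.det ^ 2 = 1 := by
  have := four_mul_det_autoMat hf
  rcases (isPellSol_pell hf.1 hf.2).cases with h | h
  · rw [h] at this; rw [show f.autoMat.det = 1 by omega]; rfl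
  · rw [h] at this; rw [show f.autoMat.det = -1 by omega]; rfl

/-- The automorph depends linearly on the coefficients once t and u are fixed, and the factor det M
in the action makes it conjugate correctly even when det M = -1. -/
theorem mul_autoMat {f : BQF} (hf : f.IsIndef) {M : Mat2} (hM : M.det ^ 2 = 1) :
    M * (f.tact M).autoMat = f.autoMat * M := by
  obtain ⟨h1, h2, h3, h4⟩ := two_mul_autoMat hf
  obtain ⟨k1, k2, k3, k4⟩ := two_mul_autoMat (hf.tact hM)
  rw [disc_tact f hM] at k1 k2 k3 k4
  generalize (pellT f.disc : ℤ) = t at *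
  generalize (pellU f.disc : ℤ) = u at *
  generalize (f.tact M).autoMat = W at *
  generalize f.autoMat = V at *
  simp only [tact] at k1 k2 k3 k4
  rw [Matrix.det_fin_two] at *
  have h2' : (2 : ℤ) ≠ 0 := two_ne_zero
  ext i j
  apply mul_left_cancel₀ h2'
  fin_cases i <;> fin_cases j <;> simp only [Matrix.mul_apply, Fin.sum_univ_two, Fin.zero_eta,
    Fin.mk_one, Fin.isValue]
  · linear_combination M 0 0 * k1 + 2 * M 0 1 * k4 - M 0 0 * h1 - 2 * M 1 0 * h3
      + u * (-f.B * M 0 0 - 2 * f.C * M 1 0) * hM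
  · linear_combination 2 * M 0 0 * k3 + M 0 1 * k2 - M 0 1 * h1 - 2 * M 1 1 * h3
      + u * (-f.B * M 0 1 - 2 * f.C * M 1 1) * hM
  · linear_combination M 1 0 * k1 + 2 * M 1 1 * k4 - 2 * M 0 0 * h4 - M 1 0 * h2
      + u * (2 * f.A * M 0 0 + f.B * M 1 0) * hM
  · linear_combination 2 * M 1 0 * k3 + M 1 1 * k2 - 2 * M 0 1 * h4 - M 1 1 * h2
      + u * (2 * f.A * M 0 1 + f.B * M 1 1) * hM

theorem tact_autoMat {f : BQF} (hf : f.IsIndef) : f.tact f.autoMat = f := by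
  obtain ⟨h1, h2, h3, h4⟩ := two_mul_autoMat hf
  have hd := det_autoMat_sq hf
  set W := f.autoMat
  have e : W 1 1 - W 0 0 = f.B * pellU f.disc := by linarith
  have hdet := Matrix.det_fin_two W
  rw [h3, h4] at hdet
  generalize (pellU f.disc : ℤ) = u at *
  have key : ∀ x y : ℤ, x = W.det * y → W.det * x = y := by
    intro x y h
    rw [h]; linear_combination y * hd
  ext
  · simp only [tact]
    refine key _ _ ?_
    rw [h4]
    linear_combination -f.A * W 0 0 * e - f.A * hdet
  · simp only [tact]
    refine key _ _ ?_
    rw [h3, h4]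
    linear_combination (2 * f.A * f.C * u) * e - f.B * hdet
  · simp only [tact]
    refine key _ _ ?_
    rw [h3]
    linear_combination (f.C * W 1 1) * e - f.C * hdet

theorem IsReduced.autoMat_entries {f : BQF} (hr : f.IsReduced) (hf : f.IsIndef) :
    0 ≤ f.autoMat 0 0 ∧ f.autoMat 0 0 ≤ f.autoMat 0 1 ∧ 0 < f.autoMat 0 1 ∧
    0 ≤ f.autoMat 1 0 ∧ f.autoMat 1 0 ≤ f.autoMat 1 1 ∧ 0 < f.autoMat 1 1 := by
  obtain ⟨h1, h2, h3, h4⟩ := two_mul_autoMat hf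
  have hd := mat2_det_sq (det_autoMat_sq hf)
  rw [Matrix.det_fin_two] at hd
  obtain ⟨ht, hu, -⟩ := isPellSol_pell hf.1 hf.2
  have hcases := (isPellSol_pell hf.1 hf.2).cases
  have ht' : (0 : ℤ) < pellT f.disc := by exact_mod_cast ht
  have hu' : (0 : ℤ) < pellU f.disc := by exact_mod_cast hu
  obtain ⟨hA, hC, hB⟩ := hr
  set W := f.autoMat
  generalize (pellT f.disc : ℤ) = t at *
  generalize (pellU f.disc : ℤ) = u at *
  have b1 : 0 < W 0 1 := by rw [h3]; exact mul_pos (by omega) hu'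
  have b2 : 0 < W 1 0 := by rw [h4]; exact mul_pos hA hu'
  -- The product of the other two entries is at least 1 and the determinant at least -1; with
  -- positive trace, both diagonal entries are nonnegative.
  have b3 : 0 ≤ W 0 0 * W 1 1 := by
    have := mul_pos b1 b2
    omega
  have b4 : 0 < W 0 0 + W 1 1 := by linarith
  have b5 : 0 ≤ W 0 0 := by
    by_contra! h
    nlinarith
  have b6 : 0 ≤ W 1 1 := by
    by_contra! h
    nlinarith
  have hu1 : 1 ≤ u ^ 2 := by nlinarith
  have c1 : W 0 0 ≤ W 0 1 := by
    have e1 : 2 * (W 0 1 - W 0 0) = (f.B - 2 * f.C) * u - t := by rw [mul_sub, h1, h3]; ring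
    have e2 : t ≤ (f.B - 2 * f.C) * u := by
      apply le_of_sq_le_sq _ (mul_nonneg (by omega) hu'.le)
      -- Reducedness makes the last term at least 4, and t² ≤ Δu² + 4.
      have e3 : ((f.B - 2 * f.C) * u) ^ 2 = f.disc * u ^ 2 + 4 * ((-f.C) * (f.B - f.A - f.C)) * u ^ 2 := by
        simp only [disc]; ring
      have e4 : 1 * 1 ≤ (-f.C) * (f.B - f.A - f.C) :=
        mul_le_mul (by omega) (by omega) (by norm_num) (by omega)
      have e5 : 1 * 1 ≤ ((-f.C) * (f.B - f.A - f.C)) * u ^ 2 :=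
        mul_le_mul (by omega) hu1 (by norm_num) (by omega)
      rw [e3]
      rcases hcases with h | h <;> nlinarith
    omega
  have c2 : W 1 0 ≤ W 1 1 := by
    have e1 : 2 * (W 1 1 - W 1 0) = t - (2 * f.A - f.B) * u := by rw [mul_sub, h2, h4]; ring
    have e2 : (2 * f.A - f.B) * u ≤ t := by
      apply le_of_sq_le_sq _ ht'.le
      have e3 : ((2 * f.A - f.B) * u) ^ 2 = f.disc * u ^ 2 - 4 * (f.A * (f.B - f.A - f.C)) * u ^ 2 := by
        simp only [disc]; ring
      have e4 : 1 * 1 ≤ f.A * (f.B - f.A - f.C) :=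
        mul_le_mul (by omega) (by omega) (by norm_num) (by omega)
      have e5 : 1 * 1 ≤ (f.A * (f.B - f.A - f.C)) * u ^ 2 :=
        mul_le_mul (by omega) hu1 (by norm_num) (by omega)
      rw [e3]
      rcases hcases with h | h <;> nlinarith
    omega
  exact ⟨b5, c1, b1, b2.le, c2, by omega⟩

end BQF

/-- The form `-f(x + y, -x)`, on which the strings act. -/
def IndefForm.toF (f : IndefForm) : BQF := ⟨f.1.B - f.1.A - f.1.C, f.1.B - 2 * f.1.A, -f.1.A⟩

/-! ### Z-reduced forms as reduced forms, and the string of a form -/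

namespace IndefForm

theorem disc_toF (f : IndefForm) : f.toF.disc = f.1.disc := by
  simp only [toF, BQF.disc]; ring

theorem isIndef_toF (f : IndefForm) : f.toF.IsIndef := by
  unfold BQF.IsIndef; rw [disc_toF]; exact f.2

theorem isReduced_toF_iff (f : IndefForm) : f.toF.IsReduced ↔ f.IsZReduced := by
  simp only [BQF.IsReduced, toF, IsZReduced]; omega

theorem toF_injective : Function.Injective toF := by
  intro f g h
  simp only [toF, BQF.mk.injEq] at h
  apply Subtype.ext
  ext <;> omega

/-- The indefinite form corresponding to `F` under `toF`. -/
def ofF (F : BQF) (hF : F.IsIndef) : IndefForm :=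
  ⟨⟨-F.C, F.B - 2 * F.C, F.B - F.C - F.A⟩, by
    have : BQF.disc ⟨-F.C, F.B - 2 * F.C, F.B - F.C - F.A⟩ = F.disc := by
      simp only [BQF.disc]; ring
    rw [this]; exact hF⟩

@[simp] theorem toF_ofF (F : BQF) (hF : F.IsIndef) : (ofF F hF).toF = F := by
  ext <;> simp [toF, ofF]; ring

theorem isUnimodular_toF_iff (f : IndefForm) : f.toF.IsUnimodular ↔ f.1.IsPrimitive := by
  rw [BQF.isPrimitive_iff]
  simp only [BQF.IsUnimodular, toF]
  constructor
  · rintro ⟨x, y, z, h⟩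
    exact ⟨-x - 2 * y - z, x + y, -x, by linear_combination h⟩
  · rintro ⟨x, y, z, h⟩
    exact ⟨-z, y + z, -x - 2 * y - z, by linear_combination h⟩

theorem toClass_eq_iff (f g : IndefForm) :
    f.toClass = g.toClass ↔ ∃ M : Mat2, M.det = 1 ∧ g.toF = f.toF.tact M := by
  have h0 : f.toClass = g.toClass ↔
      ∃ M : Matrix.SpecialLinearGroup (Fin 2) ℤ, g.1 = f.1.act M := Quotient.eq
  rw [h0]
  constructor
  · rintro ⟨S, h⟩
    -- Conjugation by the substitution (x + y, -x) defining `toF`.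
    refine ⟨!![0, -1; 1, 1] * S.1 * !![1, 1; -1, 0], ?_, ?_⟩
    · rw [Matrix.det_mul, Matrix.det_mul, S.2]; simp [Matrix.det_fin_two]
    · have hd : (!![0, -1; 1, 1] * S.1 * !![1, 1; -1, 0] : Mat2).det = 1 := by
        rw [Matrix.det_mul, Matrix.det_mul, S.2]; simp [Matrix.det_fin_two]
      have e : (!![0, -1; 1, 1] * S.1 * !![1, 1; -1, 0] : Mat2)
          = !![-S 1 0 + S 1 1, -S 1 0; S 0 0 + S 1 0 - S 0 1 - S 1 1, S 0 0 + S 1 0] := by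
        ext i j
        fin_cases i <;> fin_cases j <;> simp [Matrix.mul_apply, Matrix.vecMul, dotProduct, Fin.sum_univ_two] <;> ring
      ext <;> simp only [toF, BQF.tact, hd] <;> rw [e, h] <;> simp [BQF.act] <;> ring
  · rintro ⟨M, hM, h⟩
    refine ⟨⟨!![1, 1; -1, 0] * M * !![0, -1; 1, 1], ?_⟩, ?_⟩
    · rw [Matrix.det_mul, Matrix.det_mul, hM]; simp [Matrix.det_fin_two]
    · have e : (!![1, 1; -1, 0] * M * !![0, -1; 1, 1] : Mat2)
          = !![M 0 1 + M 1 1, M 0 1 + M 1 1 - M 0 0 - M 1 0; -M 0 1, M 0 0 - M 0 1] := by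
        ext i j
        fin_cases i <;> fin_cases j <;> simp [Matrix.mul_apply, Matrix.vecMul, dotProduct, Fin.sum_univ_two] <;> ring
      have hA := congrArg BQF.A h
      have hB := congrArg BQF.B h
      have hC := congrArg BQF.C h
      simp only [toF, BQF.tact, hM] at hA hB hC
      ext <;> simp only [BQF.act, e] <;> simp
      · linear_combination -hC
      · linear_combination hB - 2 * hC
      · linear_combination hB - hA - hC

/-- The string of a reduced form is that of its fundamental automorph. -/
theorem sigma_spec {f : IndefForm} (hf : f.IsZReduced) :
    sigma f ≠ [] ∧ wordMat (sigma f) = f.toF.autoMat := by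
  have hr := f.isReduced_toF_iff.mpr hf
  have hi := f.isIndef_toF
  obtain ⟨a1, a2, a3, a4, a5, a6⟩ := hr.autoMat_entries hi
  have hdet := BQF.det_autoMat_sq hi
  obtain ⟨w, -, hw⟩ := exists_word a1 a2 a4 a5 hdet
  obtain ⟨h1, h2, h3, h4⟩ := BQF.two_mul_autoMat hi
  have hdet4 := BQF.four_mul_det_autoMat hi
  rw [disc_toF] at h1 h2 h3 h4 hdet4
  -- The second column of the automorph is (Au, z - Au), with A the coefficient of f.
  have hval : zOf f / (zOf f - f.1.A * pellU f.1.disc)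
      = 1 + (f.toF.autoMat 0 1 : ℚ) / f.toF.autoMat 1 1 := by
    have hne : (f.toF.autoMat 1 1 : ℚ) ≠ 0 := by exact_mod_cast a6.ne'
    have e1 : (f.toF.autoMat 0 1 : ℚ) = f.1.A * pellU f.1.disc := by
      rw [h3]; simp [toF]
    have e2 : (f.toF.autoMat 1 1 : ℚ) = zOf f - f.1.A * pellU f.1.disc := by
      have : (2 : ℚ) * f.toF.autoMat 1 1 = pellT f.1.disc + (f.1.B - 2 * f.1.A) * pellU f.1.disc := by
        exact_mod_cast h2
      rw [zOf]; linarith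
    rw [← e2, one_add_div hne, e1]
    congr 1
    rw [e2]; ring
  -- The weight is one less than the number of partial quotients, so an even number of them means
  -- determinant -1, that is, norm -4.
  have hpar : ∀ q : List ℕ, q ≠ [] → ((Even q.length ↔
      (pellT f.1.disc : ℤ) ^ 2 - f.1.disc * (pellU f.1.disc : ℤ) ^ 2 = -4) ↔
      (wordMat (starsBars q)).det = f.toF.autoMat.det) := by
    intro q hq
    rw [← count_starsBars hq, ← hdet4, Nat.even_add_one, ← det_wordMat_eq_one]
    have := mat2_det_sq hdet
    have := mat2_det_sq (det_wordMat_sq (starsBars q))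
    omega
  have hex : ∃ q, IsExpansion (zOf f / (zOf f - f.1.A * pellU f.1.disc))
      ((pellT f.1.disc : ℤ) ^ 2 - f.1.disc * (pellU f.1.disc : ℤ) ^ 2 = -4) q := by
    obtain ⟨q, hq, hne, rfl⟩ := starsBars_surjective w
    refine ⟨q, hq, hne, ?_, (hpar q hne).mpr (by rw [hw])⟩
    rw [cfValue_eq hq hne, hw, hval]
  obtain ⟨hq, hne, hv, he⟩ := Classical.epsilon_spec hex
  change (∀ a ∈ beadSeq f, 0 < a) at hq
  change beadSeq f ≠ [] at hne
  change cfValue (beadSeq f) = _ at hv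
  change Even (beadSeq f).length ↔ _ at he
  have hd := (hpar _ hne).mp he
  rw [cfValue_eq hq hne, hval] at hv
  change 1 + (wordMat (sigma f) 0 1 : ℚ) / wordMat (sigma f) 1 1 = _ at hv
  change (wordMat (sigma f)).det = _ at hd
  have p1 : (0 : ℚ) < wordMat (sigma f) 1 1 := by exact_mod_cast wordMat_one_one_pos _
  have p2 : (0 : ℚ) < f.toF.autoMat 1 1 := by exact_mod_cast a6
  have hratio : f.toF.autoMat 0 1 * wordMat (sigma f) 1 1
      = wordMat (sigma f) 0 1 * f.toF.autoMat 1 1 := by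
    have := add_left_cancel hv
    rw [div_eq_div_iff p1.ne' p2.ne'] at this
    exact_mod_cast this.symm
  have hnil : sigma f ≠ [] := by
    intro h
    rw [h] at hratio
    simp at hratio
    omega
  refine ⟨hnil, (mat2_eq_of_ratio hdet hd.symm a1 (wordMat_nonneg _ _ _) a3 a6
    (wordMat_one_one_pos _) a2 (wordMat_col_le hnil 0) a4 (wordMat_nonneg _ _ _) a5
    (wordMat_col_le hnil 1) hratio).symm⟩

end IndefForm

/-! ### Cancellation and conjugacy of strings -/

theorem mat2_mul_left_cancel {M N P : Mat2} (hM : M.det ^ 2 = 1) (h : M * N = M * P) : N = P := by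
  have h' := congrArg (M.adjugate * ·) h
  simp only [← Matrix.mul_assoc, Matrix.adjugate_mul] at h'
  rcases mat2_det_sq hM with e | e
  · simpa [e] using h'
  · simpa [e] using h'

theorem eq_of_prefix_of_wordMat_eq {v w : List Bool} (h : v <+: w) (e : wordMat v = wordMat w) :
    v = w := by
  obtain ⟨r, rfl⟩ := h
  rw [wordMat_append] at e
  have := mat2_mul_left_cancel (det_wordMat_sq v) (e.symm.trans (mul_one _).symm)
  rw [wordMat_eq_one this, List.append_nil]

/-- Two strings intertwined by a third one are conjugate. -/
theorem exists_conj_of_append_eq {a b : List Bool} (ha : a ≠ []) (n : ℕ) :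
    ∀ w : List Bool, w.length ≤ n → w ++ b = a ++ w →
      ∃ p r : List Bool, ∃ k : ℕ, a = p ++ r ∧ b = r ++ p ∧
        w.count true = k * a.count true + p.count true := by
  induction n with
  | zero =>
    intro w hw h
    obtain rfl : w = [] := List.length_eq_zero_iff.mp (by omega)
    exact ⟨[], a, 0, by simp, by simpa using h, by simp⟩
  | succ n ih =>
    intro w hw h
    have h1 : w <+: a ++ w := ⟨b, h⟩
    rcases List.prefix_or_prefix_of_prefix h1 (List.prefix_append a w) with ⟨r, hr⟩ | ⟨w', rfl⟩
    · refine ⟨w, r, 0, hr.symm, ?_, by simp⟩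
      rw [← hr, List.append_assoc] at h
      exact List.append_cancel_left h
    · rw [List.append_assoc] at h
      have hl : 0 < a.length := List.length_pos_iff.mpr ha
      obtain ⟨p, r, k, h1, h2, h3⟩ := ih w' (by simp at hw; omega) (List.append_cancel_left h)
      exact ⟨p, r, k + 1, h1, h2, by rw [List.count_append, h3]; ring⟩

/-! ### Strings fixing a primitive reduced form -/

namespace BQF

/-- A string fixing a primitive reduced form gives a solution of the Pell equation. -/
theorem IsReduced.exists_pellSol {f : BQF} (hr : f.IsReduced) (hi : f.IsIndef)
    (hu : f.IsUnimodular) {w : List Bool} (hw : w ≠ []) (h : f.wact w = f) :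
    ∃ t u : ℕ, IsPellSol f.disc t u ∧ wordMat w 1 0 = f.A * u ∧
      wordMat w 1 1 - wordMat w 0 0 = f.B * u ∧ wordMat w 0 1 = -f.C * u ∧
      wordMat w 0 0 + wordMat w 1 1 = t ∧
      (t : ℤ) ^ 2 - f.disc * (u : ℤ) ^ 2 = 4 * (wordMat w).det := by
  have hd := det_wordMat_sq w
  have hcomm := mul_autoMat hi hd
  rw [show f.tact (wordMat w) = f from h] at hcomm
  obtain ⟨h1, h2, h3, h4⟩ := two_mul_autoMat hi
  have n00 := wordMat_nonneg w 0 0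
  have n10 := wordMat_nonneg w 1 0
  have l0 := wordMat_col_le hw 0
  have l1 := wordMat_col_le hw 1
  have p11 := wordMat_one_one_pos w
  obtain ⟨-, hu0, -⟩ := isPellSol_pell hi.1 hi.2
  have hu0' : (pellU f.disc : ℤ) ≠ 0 := by exact_mod_cast hu0.ne'
  set N := wordMat w
  have c00 := congrFun (congrFun hcomm 0) 0
  have c01 := congrFun (congrFun hcomm 0) 1
  have c10 := congrFun (congrFun hcomm 1) 0
  simp only [Matrix.mul_apply, Fin.sum_univ_two] at c00 c01 c10
  -- Commuting with the automorph makes (N₁₀, N₁₁ - N₀₀, -N₀₁) proportional to (A, B, C);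
  -- unimodularity makes the factor U below an integer.
  have e1 : f.A * N 0 1 = -f.C * N 1 0 := by
    apply mul_left_cancel₀ hu0'
    rw [h3, h4] at c00
    linear_combination c00
  have e2 : f.A * (N 1 1 - N 0 0) = f.B * N 1 0 := by
    apply mul_left_cancel₀ hu0'
    rw [h4] at c10
    linear_combination c10
      + N 1 0 * (by linarith : f.autoMat 1 1 - f.autoMat 0 0 = f.B * pellU f.disc)
  have e3 : f.B * N 0 1 = -f.C * (N 1 1 - N 0 0) := by
    apply mul_left_cancel₀ hu0'
    rw [h3] at c01
    linear_combination c01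
      - N 0 1 * (by linarith : f.autoMat 1 1 - f.autoMat 0 0 = f.B * pellU f.disc)
  obtain ⟨x, y, z, hxyz⟩ := hu
  obtain ⟨U, hU⟩ : ∃ U : ℤ, U = x * N 1 0 + y * (N 1 1 - N 0 0) - z * N 0 1 := ⟨_, rfl⟩
  have a1 : N 1 0 = f.A * U := by
    rw [hU]; linear_combination -N 1 0 * hxyz - y * e2 + z * e1
  have a2 : N 1 1 - N 0 0 = f.B * U := by
    rw [hU]; linear_combination -(N 1 1 - N 0 0) * hxyz + x * e2 + z * e3
  have a3 : N 0 1 = -f.C * U := by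
    rw [hU]; linear_combination -N 0 1 * hxyz + x * e1 + y * e3
  have hdet := Matrix.det_fin_two N
  have hUpos : 0 < U := by
    obtain ⟨hA, hC, -⟩ := hr
    by_contra! hc
    have : N 0 1 ≤ 0 := by
      rw [a3]; exact mul_nonpos_of_nonneg_of_nonpos (by omega) hc
    rw [show N 0 0 = 0 by omega, show N 0 1 = 0 by omega] at hdet
    rw [hdet] at hd
    simp at hd
  have hTU : (N 0 0 + N 1 1) ^ 2 - f.disc * U ^ 2 = 4 * N.det := by
    have : (N 0 0 + N 1 1) ^ 2 - (f.B * U) ^ 2 - 4 * ((-f.C * U) * (f.A * U)) = 4 * N.det := by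
      rw [← a1, ← a2, ← a3, hdet]; ring
    rw [← this]; simp only [disc]; ring
  obtain ⟨T, hT⟩ : ∃ T : ℕ, N 0 0 + N 1 1 = T := ⟨(N 0 0 + N 1 1).toNat, by omega⟩
  obtain ⟨V, rfl⟩ : ∃ V : ℕ, U = V := ⟨U.toNat, by omega⟩
  rw [hT] at hTU
  refine ⟨T, V, ⟨by omega, by omega, ?_⟩, a1, a2, a3, hT, hTU⟩
  rw [hTU]
  rcases mat2_det_sq hd with h | h <;> rw [h] <;> norm_num

/-- A primitive reduced form is determined by a string fixing it. -/
theorem IsReduced.eq_of_wact_eq {f g : BQF} (hf : f.IsReduced) (hfi : f.IsIndef)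
    (hfu : f.IsUnimodular) (hg : g.IsReduced) (hgi : g.IsIndef) (hgu : g.IsUnimodular)
    {w : List Bool} (hw : w ≠ []) (h : f.wact w = f) (h' : g.wact w = g) : f = g := by
  obtain ⟨-, u, ⟨-, hu, -⟩, a1, a2, a3, -⟩ := hf.exists_pellSol hfi hfu hw h
  obtain ⟨-, v, ⟨-, hv, -⟩, b1, b2, b3, -⟩ := hg.exists_pellSol hgi hgu hw h'
  obtain ⟨x, y, z, hf1⟩ := hfu
  obtain ⟨x', y', z', hg1⟩ := hgu
  rw [a1] at b1; rw [a2] at b2; rw [a3] at b3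
  have d1 : (v : ℤ) ∣ u := ⟨x * g.A + y * g.B + z * g.C, by
    linear_combination -(u : ℤ) * hf1 + x * b1 + y * b2 - z * b3⟩
  have d2 : (u : ℤ) ∣ v := ⟨x' * f.A + y' * f.B + z' * f.C, by
    linear_combination -(v : ℤ) * hg1 - x' * b1 - y' * b2 + z' * b3⟩
  have : (u : ℤ) = v := Int.dvd_antisymm (by omega) (by omega) d2 d1
  rw [← this] at b1 b2 b3
  have hu' : (u : ℤ) ≠ 0 := by omega
  ext
  · exact mul_right_cancel₀ hu' b1
  · exact mul_right_cancel₀ hu' b2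
  · exact neg_injective (mul_right_cancel₀ hu' b3)

/-- The fundamental automorph of a primitive reduced form is not a product of automorphs. -/
theorem IsReduced.autoMat_indecomposable {f : BQF} (hr : f.IsReduced) (hi : f.IsIndef)
    (hu : f.IsUnimodular) {p r : List Bool} (hp : p ≠ []) (h : f.wact p = f)
    (hpr : wordMat (p ++ r) = f.autoMat) : r = [] := by
  by_contra hrne
  have hr' : f.wact r = f := by
    have : f.wact (p ++ r) = f := by rw [wact, hpr, tact_autoMat hi]
    rwa [wact_append, h] at this
  obtain ⟨T, U, hTU, a1, a2, a3, a4, a5⟩ := hr.exists_pellSol hi hu hp h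
  obtain ⟨T', U', hTU', b1, b2, b3, b4, b5⟩ := hr.exists_pellSol hi hu hrne hr'
  obtain ⟨h1, h2, h3, h4⟩ := two_mul_autoMat hi
  have hU := pellU_le hTU
  have hU' := pellU_le hTU'
  obtain ⟨ht0, hu0, -⟩ := isPellSol_pell hi.1 hi.2
  have hdet4 := four_mul_det_autoMat hi
  have hmin : ∀ t : ℕ, IsPellSol f.disc t (pellU f.disc) → pellT f.disc ≤ t := fun t => pellT_le
  rw [← hpr, wordMat_append] at h4 hdet4
  rw [Matrix.det_mul] at hdet4
  simp only [Matrix.mul_apply, Fin.sum_univ_two] at h4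
  generalize pellT f.disc = t at *
  generalize pellU f.disc = u at *
  have e1 : 2 * wordMat p 1 1 = T + f.B * U := by linarith
  have e2 : 2 * wordMat r 0 0 = T' - f.B * U' := by linarith
  -- The lower left entry of the product. As U, U' ≥ u and T, T' ≥ 1, this forces U = U' = u and T =
  -- T' = 1.
  have key : (2 * u : ℤ) = T * U' + U * T' := by
    apply mul_left_cancel₀ hr.1.ne'
    rw [a1, b1] at h4
    linear_combination (-2 : ℤ) * h4 + f.A * U * e2 + f.A * U' * e1
  have key' : 2 * u = T * U' + U * T' := by exact_mod_cast key
  have hT := hTU.1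
  have hT' := hTU'.1
  have k1 : U' ≤ T * U' := Nat.le_mul_of_pos_left _ hT
  have k2 : U ≤ U * T' := Nat.le_mul_of_pos_right _ hT'
  obtain rfl : U = u := by omega
  obtain rfl : U' = U := by omega
  have hT1 : T = 1 := by
    have : T * U' = 1 * U' := by omega
    exact Nat.eq_of_mul_eq_mul_right hu0 this
  have hT1' : T' = 1 := by
    have : U' * T' = U' * 1 := by omega
    exact Nat.eq_of_mul_eq_mul_left hu0 this
  subst hT1 hT1'
  -- Here the minimality of t enters, as needed for Δ = 5: t = 1 gives norm -4, whereas the product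
  -- of two automorphs of determinant -1 has norm 4.
  have := hmin 1 hTU
  obtain rfl : t = 1 := by omega
  have d1 := mat2_det_sq (det_wordMat_sq p)
  have d2 := mat2_det_sq (det_wordMat_sq r)
  have hpos : 0 < f.disc * (U' : ℤ) ^ 2 := mul_pos hi.1 (by positivity)
  have d1' : (wordMat p).det = -1 := by omega
  have d2' : (wordMat r).det = -1 := by omega
  rw [d1', d2'] at hdet4
  omega

end BQF

/-! ### The string of a form as its shortest period -/

namespace IndefForm

theorem wact_sigma {f : IndefForm} (hf : f.IsZReduced) : f.toF.wact (sigma f) = f.toF := by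
  rw [BQF.wact, (sigma_spec hf).2, BQF.tact_autoMat f.isIndef_toF]

/-- Both sides have the same matrix by `mul_autoMat` and both keep f reduced. One is thus a prefix
of the other, and the remainder, having matrix 1, is empty. -/
theorem append_sigma {f g : IndefForm} (hf : f.IsZReduced) (hg : g.IsZReduced) {w : List Bool}
    (h : f.toF.wact w = g.toF) : w ++ sigma g = sigma f ++ w := by
  have hfr := f.isReduced_toF_iff.mpr hf
  have hgr := g.isReduced_toF_iff.mpr hg
  have e : wordMat (w ++ sigma g) = wordMat (sigma f ++ w) := by
    rw [wordMat_append, wordMat_append, (sigma_spec hf).2, (sigma_spec hg).2, ← h]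
    exact BQF.mul_autoMat f.isIndef_toF (det_wordMat_sq w)
  have r1 : (f.toF.wact (w ++ sigma g)).IsReduced := by
    rwa [BQF.wact_append, h, wact_sigma hg]
  have r2 : (f.toF.wact (sigma f ++ w)).IsReduced := by
    rwa [BQF.wact_append, wact_sigma hf, h]
  rcases le_total (w ++ sigma g).length (sigma f ++ w).length with hl | hl
  · exact eq_of_prefix_of_wordMat_eq (hfr.prefix_of_length_le f.isIndef_toF r1 r2 hl) e
  · exact (eq_of_prefix_of_wordMat_eq (hfr.prefix_of_length_le f.isIndef_toF r2 r1 hl) e.symm).symm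

theorem length_sigma_eq {f g : IndefForm} (hf : f.IsZReduced) (hg : g.IsZReduced) {w : List Bool}
    (h : f.toF.wact w = g.toF) : (sigma g).length = (sigma f).length := by
  have := congrArg List.length (append_sigma hf hg h)
  simp at this; omega

/-- A nonempty string fixing a primitive reduced form begins with the string of the form. -/
theorem sigma_prefix {f : IndefForm} (hf : f.IsZReduced) (hp : f.1.IsPrimitive) {w : List Bool}
    (hw : w ≠ []) (h : f.toF.wact w = f.toF) : sigma f <+: w := by
  have hr := f.isReduced_toF_iff.mpr hf
  have hs := sigma_spec hf
  have h1 : (f.toF.wact w).IsReduced := by rwa [h]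
  have h2 : (f.toF.wact (sigma f)).IsReduced := by rwa [wact_sigma hf]
  rcases le_total (sigma f).length w.length with hl | hl
  · exact hr.prefix_of_length_le f.isIndef_toF h2 h1 hl
  · obtain ⟨r, hr'⟩ := hr.prefix_of_length_le f.isIndef_toF h1 h2 hl
    have := hr.autoMat_indecomposable f.isIndef_toF (f.isUnimodular_toF_iff.mpr hp) hw h
      (by rw [hr', hs.2])
    rw [← hr', this, List.append_nil]

/-- Strip copies of σ(f) by `sigma_prefix`: a string fixing f is a power of σ(f). -/
theorem even_count_of_wact_eq {f : IndefForm} (hf : f.IsZReduced) (hp : f.1.IsPrimitive)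
    (he : Even ((sigma f).count true)) (n : ℕ) : ∀ w : List Bool, w.length ≤ n →
      f.toF.wact w = f.toF → Even (w.count true) := by
  induction n with
  | zero =>
    intro w hw _
    obtain rfl : w = [] := List.length_eq_zero_iff.mp (by omega)
    simp
  | succ n ih =>
    intro w hw h
    by_cases hne : w = []
    · simp [hne]
    · obtain ⟨r, rfl⟩ := sigma_prefix hf hp hne h
      have hl : 0 < (sigma f).length := List.length_pos_iff.mpr (sigma_spec hf).1
      rw [BQF.wact_append, wact_sigma hf] at h
      rw [List.count_append]
      exact he.add (ih r (by simp at hw; omega) h)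

/-- Equivalent reduced forms are connected by a string of even weight. -/
theorem exists_wact_of_toClass_eq {f g : IndefForm} (hf : f.IsZReduced) (hg : g.IsZReduced)
    (h : f.toClass = g.toClass) : ∃ w : List Bool, f.toF.wact w = g.toF ∧ Even (w.count true) := by
  obtain ⟨M, hM, hg'⟩ := (toClass_eq_iff f g).mp h
  obtain ⟨w, hw, hd⟩ := (f.isReduced_toF_iff.mpr hf).exists_wact_eq (sigma_spec hf).1
    (wact_sigma hf) (M := M) (by rw [hM]; rfl) (by rw [← hg']; exact g.isReduced_toF_iff.mpr hg)
  exact ⟨w, by rw [hw, hg'], by rw [← det_wordMat_eq_one, hd, hM]⟩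

theorem toClass_eq_of_wact {f g : IndefForm} {w : List Bool} (h : f.toF.wact w = g.toF)
    (he : Even (w.count true)) : f.toClass = g.toClass :=
  (toClass_eq_iff f g).mpr ⟨wordMat w, det_wordMat_eq_one.mpr he, h.symm⟩

/-- The form obtained by letting a string act. -/
def shift (f : IndefForm) (w : List Bool) : IndefForm := ofF (f.toF.wact w) (f.isIndef_toF.wact w)

@[simp] theorem toF_shift (f : IndefForm) (w : List Bool) : (f.shift w).toF = f.toF.wact w :=
  toF_ofF _ _

theorem isPrimitive_shift {f : IndefForm} (hf : f.1.IsPrimitive) (w : List Bool) :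
    (f.shift w).1.IsPrimitive := by
  rw [← isUnimodular_toF_iff, toF_shift]
  exact (f.isUnimodular_toF_iff.mpr hf).tact (det_wordMat_sq w)

theorem isPrimitive_toClass_iff (f : IndefForm) : f.toClass.IsPrimitive ↔ f.1.IsPrimitive := by
  refine ⟨fun h => h f rfl, fun h g hg => ?_⟩
  obtain ⟨M, hM, hf⟩ := (toClass_eq_iff g f).mp hg
  rw [← isUnimodular_toF_iff] at h ⊢
  rw [hf] at h
  exact h.of_tact

/-! ## Every class contains a reduced form -/

theorem toClass_eq_of_act {f g : IndefForm} (M : Matrix.SpecialLinearGroup (Fin 2) ℤ)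
    (h : g.1 = f.1.act M) : f.toClass = g.toClass := Quotient.sound ⟨M, h⟩

theorem isIndef_act (f : IndefForm) (M : Matrix.SpecialLinearGroup (Fin 2) ℤ) :
    0 < (f.1.act M).disc ∧ ¬ IsSquare (f.1.act M).disc := by
  rw [← BQF.tact_eq_act]
  exact BQF.IsIndef.tact f.2 (by rw [M.2]; rfl)

/-- Gauss reduction: translate until |B| ≤ |A|. If still AC ≥ 0, then 4AC < B² ≤ A² gives |C| < |A|,
and exchanging A and C lowers |A|. -/
theorem exists_mul_neg (n : ℕ) : ∀ f : IndefForm, f.1.A.natAbs ≤ n →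
    ∃ g : IndefForm, f.toClass = g.toClass ∧ g.1.A * g.1.C < 0 := by
  induction n with
  | zero =>
    intro f hf
    have := BQF.IsIndef.eval_ne_zero f.2 (x := 1) (y := 0) (by simp)
    simp [BQF.eval] at this
    omega
  | succ n ih =>
    intro f hf
    have hA : f.1.A ≠ 0 := by
      have := BQF.IsIndef.eval_ne_zero f.2 (x := 1) (y := 0) (by simp)
      simpa [BQF.eval] using this
    obtain ⟨k, hk⟩ : ∃ k : ℤ, (f.1.B + 2 * f.1.A * k).natAbs ≤ f.1.A.natAbs := by
      refine ⟨-((f.1.B + |f.1.A|) / (2 * f.1.A)), ?_⟩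
      have h1 := Int.emod_add_mul_ediv (f.1.B + |f.1.A|) (2 * f.1.A)
      have h2 := Int.emod_nonneg (f.1.B + |f.1.A|) (b := 2 * f.1.A) (by omega)
      have h3 := Int.emod_lt_abs (f.1.B + |f.1.A|) (b := 2 * f.1.A) (by omega)
      rw [abs_mul, abs_two] at h3
      have h4 : f.1.B + 2 * f.1.A * -((f.1.B + |f.1.A|) / (2 * f.1.A))
          = (f.1.B + |f.1.A|) % (2 * f.1.A) - |f.1.A| := by linarith
      rw [h4]
      have := Int.natCast_natAbs f.1.A
      omega
    have e1 : f.1.act ⟨!![1, k; 0, 1], by simp [Matrix.det_fin_two]⟩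
        = ⟨f.1.A, f.1.B + 2 * f.1.A * k, f.1.A * k ^ 2 + f.1.B * k + f.1.C⟩ := by
      ext <;> simp [BQF.act]; ring
    have hi := isIndef_act f ⟨!![1, k; 0, 1], by simp [Matrix.det_fin_two]⟩
    obtain ⟨g, hg⟩ : ∃ g : IndefForm, g.1 = f.1.act ⟨!![1, k; 0, 1], by simp [Matrix.det_fin_two]⟩ :=
      ⟨⟨_, hi⟩, rfl⟩
    have hfg := toClass_eq_of_act _ hg
    rw [e1] at hg
    have gA : g.1.A = f.1.A := by rw [hg]
    have gB : g.1.B = f.1.B + 2 * f.1.A * k := by rw [hg]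
    rw [← gB, ← gA] at hk
    rw [← gA] at hA hf
    have hdisc : 0 < g.1.disc := g.2.1
    by_cases hneg : g.1.A * g.1.C < 0
    · exact ⟨g, hfg, hneg⟩
    · push Not at hneg
      have hB2 : g.1.B ^ 2 ≤ g.1.A ^ 2 := Int.natAbs_le_iff_sq_le.mp hk
      have hC : g.1.C.natAbs < g.1.A.natAbs := by
        rw [BQF.disc] at hdisc
        by_contra! hc
        have h1 : g.1.A.natAbs * g.1.A.natAbs ≤ g.1.A.natAbs * g.1.C.natAbs := by gcongr
        have h2 : ((g.1.A.natAbs * g.1.A.natAbs : ℕ) : ℤ) = g.1.A ^ 2 := by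
          rw [Int.natAbs_mul_self]; ring
        have h3 : ((g.1.A.natAbs * g.1.C.natAbs : ℕ) : ℤ) = g.1.A * g.1.C := by
          rw [← Int.natAbs_mul, Int.natAbs_of_nonneg hneg]
        have h4 : ((g.1.A.natAbs * g.1.A.natAbs : ℕ) : ℤ)
          ≤ ((g.1.A.natAbs * g.1.C.natAbs : ℕ) : ℤ) := by exact_mod_cast h1
        rw [h2, h3] at h4
        nlinarith [sq_nonneg g.1.A]
      have e2 : g.1.act ⟨!![0, -1; 1, 0], by simp [Matrix.det_fin_two]⟩
          = ⟨g.1.C, -g.1.B, g.1.A⟩ := by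
        ext <;> simp [BQF.act]
      have hi' := isIndef_act g ⟨!![0, -1; 1, 0], by simp [Matrix.det_fin_two]⟩
      obtain ⟨g', hg'⟩ : ∃ g' : IndefForm,
          g'.1 = g.1.act ⟨!![0, -1; 1, 0], by simp [Matrix.det_fin_two]⟩ := ⟨⟨_, hi'⟩, rfl⟩
      have hgg' := toClass_eq_of_act _ hg'
      rw [e2] at hg'
      obtain ⟨k, hk1, hk2⟩ := ih g' (by rw [hg']; simp only; omega)
      exact ⟨k, (hfg.trans hgg').trans hk1, hk2⟩

/-- With A > 0 > C, translate by the first m ≥ 0 for which f(m, 1) > 0. The new C is f(m, 1) > 0,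
and the new A - B + C is f(m - 1, 1) < 0. -/
theorem exists_isZReduced (f : IndefForm) :
    ∃ g : IndefForm, f.toClass = g.toClass ∧ g.IsZReduced := by
  obtain ⟨h, hfh, hneg⟩ := exists_mul_neg _ f le_rfl
  obtain ⟨g, hfg, hA, hC⟩ : ∃ g : IndefForm, f.toClass = g.toClass ∧ 0 < g.1.A ∧ g.1.C < 0 := by
    rcases lt_or_gt_of_ne (left_ne_zero_of_mul hneg.ne) with hA | hA
    · have hC : 0 < h.1.C := by
        by_contra! hc
        exact absurd (mul_nonneg_of_nonpos_of_nonpos hA.le hc) (not_le.mpr hneg)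
      have e2 : h.1.act ⟨!![0, -1; 1, 0], by simp [Matrix.det_fin_two]⟩
          = ⟨h.1.C, -h.1.B, h.1.A⟩ := by
        ext <;> simp [BQF.act]
      have hi' := isIndef_act h ⟨!![0, -1; 1, 0], by simp [Matrix.det_fin_two]⟩
      rw [e2] at hi'
      exact ⟨⟨_, hi'⟩, hfh.trans (toClass_eq_of_act _ e2.symm), hC, hA⟩
    · exact ⟨h, hfh, hA, (pos_iff_neg_of_mul_neg hneg).mp hA⟩
  have hex : ∃ n : ℕ, 0 < g.1.eval n 1 := by
    refine ⟨g.1.B.natAbs + g.1.C.natAbs + 1, ?_⟩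
    simp only [BQF.eval]
    push_cast
    have h1 := neg_abs_le g.1.B
    have h2 := neg_abs_le g.1.C
    have h3 := abs_nonneg g.1.B
    have h4 := abs_nonneg g.1.C
    generalize |g.1.B| = b at *
    generalize |g.1.C| = c at *
    have h5 : 1 * (b + c + 1) ^ 2 ≤ g.1.A * (b + c + 1) ^ 2 := by gcongr; omega
    have h6 : -b * (b + c + 1) ≤ g.1.B * (b + c + 1) := by gcongr
    nlinarith [mul_nonneg h3 h4, mul_nonneg h4 h4]
  classical
  obtain ⟨m, hm, hmin⟩ : ∃ m : ℕ, 0 < g.1.eval m 1 ∧ ∀ k < m, ¬ 0 < g.1.eval k 1 :=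
    ⟨Nat.find hex, Nat.find_spec hex, fun k hk => Nat.find_min hex hk⟩
  obtain ⟨n, rfl⟩ : ∃ n, m = n + 1 := by
    refine Nat.exists_eq_succ_of_ne_zero ?_
    rintro rfl
    simp [BQF.eval] at hm
    omega
  have hn := hmin n (by omega)
  have hne := BQF.IsIndef.eval_ne_zero g.2 (x := n) (y := 1) (by simp)
  simp only [BQF.eval] at hm hn hne
  push_cast at hm
  have e : g.1.act ⟨!![1, (n : ℤ) + 1; 0, 1], by simp [Matrix.det_fin_two]⟩
      = ⟨g.1.A, g.1.B + 2 * g.1.A * (n + 1),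
        g.1.A * (n + 1) ^ 2 + g.1.B * (n + 1) + g.1.C⟩ := by
    ext <;> simp [BQF.act]; ring
  have hi := isIndef_act g ⟨!![1, (n : ℤ) + 1; 0, 1], by simp [Matrix.det_fin_two]⟩
  rw [e] at hi
  refine ⟨⟨_, hi⟩, hfg.trans (toClass_eq_of_act _ e.symm), hA, ?_, ?_, ?_⟩
  · simp only; nlinarith
  · simp only; linarith
  · simp only
    have : g.1.A * (n : ℤ) ^ 2 + g.1.B * n * 1 + g.1.C * 1 ^ 2 < 0 := by omega
    nlinarith

end IndefForm

/-! ## Classes and their necklaces -/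

theorem weight_coe (l : List Bool) : weight (l : Cycle Bool) = l.count true := by
  simp [weight]

namespace FormClass

theorem exists_toClass (c : FormClass) : ∃ f : IndefForm, f.toClass = c := Quotient.exists_rep c

theorem zForms_nonempty (c : FormClass) : c.zForms.Nonempty := by
  obtain ⟨f, rfl⟩ := c.exists_toClass
  obtain ⟨g, h, hg⟩ := f.exists_isZReduced
  exact ⟨g, h.symm, hg⟩

theorem zRep_mem (c : FormClass) : c.zRep ∈ c.zForms := Classical.epsilon_spec c.zForms_nonempty

end FormClass

namespace IndefForm

theorem exists_sigma_eq_append {f g : IndefForm} (hf : f.IsZReduced) (hg : g.IsZReduced)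
    {w : List Bool} (h : f.toF.wact w = g.toF) : ∃ p r : List Bool, ∃ k : ℕ,
      sigma f = p ++ r ∧ sigma g = r ++ p ∧
        w.count true = k * (sigma f).count true + p.count true :=
  exists_conj_of_append_eq (sigma_spec hf).1 _ w le_rfl (append_sigma hf hg h)

theorem sigma_cycle_eq {f g : IndefForm} (hf : f.IsZReduced) (hg : g.IsZReduced)
    {w : List Bool} (h : f.toF.wact w = g.toF) :
    ((sigma f : List Bool) : Cycle Bool) = (sigma g : List Bool) := by
  obtain ⟨p, r, -, h1, h2, -⟩ := exists_sigma_eq_append hf hg h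
  rw [h1, h2, Cycle.coe_eq_coe]
  exact List.isRotated_append

theorem sigmaBar_eq {c : FormClass} {f : IndefForm} (hf : f ∈ c.zForms) :
    ((sigma f : List Bool) : Cycle Bool) = sigmaBar c := by
  obtain ⟨w, hw, -⟩ := exists_wact_of_toClass_eq hf.2 c.zRep_mem.2 (hf.1.trans c.zRep_mem.1.symm)
  exact sigma_cycle_eq hf.2 c.zRep_mem.2 hw

end IndefForm

theorem colour_append (v w : List Bool) : ∀ g : Bool, colour g (v ++ w) =
    colour g v ++ colour (if Even (v.count true) then g else !g) w := by
  induction v with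
  | nil => intro g; simp [colour]
  | cons x v ih =>
    intro g
    cases x
    · simp [colour, ih]
    · by_cases h : Even (v.count true) <;> simp [colour, ih, h, Nat.even_add_one]

theorem colour_append_of_even {v : List Bool} (hv : Even (v.count true)) (w : List Bool)
    (g : Bool) : colour g (v ++ w) = colour g v ++ colour g w := by
  rw [colour_append, if_pos hv]

/-- The connecting string has even weight and consists of some turns of σ(f) followed by the prefix
p that is rotated away. So p has even weight, and the colouring restarts with green after it. -/
theorem altNecklace_eq {c : FormClass} (h : Even (weight (sigmaBar c))) {f : IndefForm}
    (hf : f ∈ c.zForms) (hf' : Even (weight ((sigma f : List Bool) : Cycle Bool))) :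
    altNecklace (sigma f) hf' = altSigmaBar c h := by
  obtain ⟨w, hw, he⟩ := IndefForm.exists_wact_of_toClass_eq hf.2 c.zRep_mem.2
    (hf.1.trans c.zRep_mem.1.symm)
  obtain ⟨p, r, k, h1, h2, h3⟩ := IndefForm.exists_sigma_eq_append hf.2 c.zRep_mem.2 hw
  apply Quotient.sound
  change (colour true (sigma f)).IsRotated (colour true (sigma c.zRep))
  rw [weight_coe] at hf'
  have hp : Even (p.count true) := by
    rw [h3] at he
    exact (Nat.even_add.mp he).mp (hf'.mul_left k)
  have hr : Even (r.count true) := by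
    rw [h1, List.count_append] at hf'
    exact (Nat.even_add.mp hf').mp hp
  rw [h1, h2, colour_append_of_even hp, colour_append_of_even hr]
  exact List.isRotated_append

theorem underlying_altNecklace (l : List Bool) (h : Even (weight (l : Cycle Bool))) :
    (altNecklace l h).underlying = l := by
  change (((colour true l).map Bead.toBool : List Bool) : Cycle Bool) = l
  rw [map_toBool_colour]

/-! ### The form of a primitive string -/

theorem wordMat_one_zero_pos {w : List Bool} (hw : true ∈ w) : 0 < wordMat w 1 0 := by
  induction w with
  | nil => simp at hw
  | cons x w ih =>
    cases x
    · rw [wordMat_false_cons]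
      simpa using ih (by simpa using hw)
    · rw [wordMat_true_cons]
      have h0 := wordMat_nonneg w 0 0
      have h1 := wordMat_nonneg w 1 0
      have hd := det_wordMat_sq w
      simp
      by_contra! hc
      rw [Matrix.det_fin_two, show wordMat w 0 0 = 0 by omega, show wordMat w 1 0 = 0 by omega] at hd
      simp at hd

/-- The form is (γ, δ - α, -β) divided by its content, where [α β; γ δ] is the matrix of v. A bead 1
is needed for γ > 0. -/
theorem exists_form_of_word {v : List Bool} (hv : true ∈ v) :
    ∃ F : BQF, F.IsReduced ∧ F.IsIndef ∧ F.IsUnimodular ∧ F.wact v = F := by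
  have hne : v ≠ [] := by rintro rfl; simp at hv
  have hγ := wordMat_one_zero_pos hv
  have hα := wordMat_nonneg v 0 0
  have l0 := wordMat_col_le hne 0
  have l1 := wordMat_col_le hne 1
  have hd := det_wordMat_sq v
  obtain ⟨α, β, γ, δ, hN⟩ : ∃ α β γ δ : ℤ, wordMat v = !![α, β; γ, δ] :=
    ⟨_, _, _, _, Matrix.eta_fin_two _⟩
  have hdet := Matrix.det_fin_two (wordMat v)
  have hact : ∀ F : BQF, F.wact v = F.tact !![α, β; γ, δ] := fun F => by rw [BQF.wact, hN]
  simp only [hN, Matrix.of_apply, Matrix.cons_val', Matrix.cons_val_zero, Matrix.cons_val_one,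
    Matrix.cons_val_fin_one] at hγ hα l0 l1 hdet hd
  set e := (!![α, β; γ, δ] : Mat2).det with he
  have hβ : 0 < β := by
    by_contra! hc
    rw [hdet, show α = 0 by omega, show β = 0 by omega] at hd
    simp at hd
  have hsum : 0 < (β - α) + (δ - γ) := by
    by_contra! hc
    rw [hdet, show α = β by omega, show γ = δ by omega] at hd
    simp at hd
  obtain ⟨g, A, B, C, x, y, z, hg, rA, rB, rC, hxyz⟩ : ∃ g A B C x y z : ℤ, 0 < g ∧ γ = g * A ∧
      δ - α = g * B ∧ -β = g * C ∧ x * A + y * B + z * C = 1 := by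
    have hg : 0 < (Int.gcd (Int.gcd γ (δ - α)) (-β) : ℤ) := by
      have := Int.gcd_pos_of_ne_zero_right (Int.gcd γ (δ - α) : ℤ) (b := -β) (by omega)
      exact_mod_cast this
    have h1 := Int.gcd_dvd_left (Int.gcd γ (δ - α) : ℤ) (-β)
    obtain ⟨C, hC⟩ := Int.gcd_dvd_right (Int.gcd γ (δ - α) : ℤ) (-β)
    obtain ⟨A, hA⟩ := h1.trans (Int.gcd_dvd_left γ (δ - α))
    obtain ⟨B, hB⟩ := h1.trans (Int.gcd_dvd_right γ (δ - α))
    have b1 := Int.gcd_eq_gcd_ab (Int.gcd γ (δ - α)) (-β)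
    have b2 := Int.gcd_eq_gcd_ab γ (δ - α)
    generalize Int.gcdA (Int.gcd γ (δ - α)) (-β) = k at b1
    generalize Int.gcdB (Int.gcd γ (δ - α)) (-β) = l at b1
    generalize (Int.gcd (Int.gcd γ (δ - α)) (-β) : ℤ) = g at *
    refine ⟨g, A, B, C, Int.gcdA γ (δ - α) * k, Int.gcdB γ (δ - α) * k, l, hg, hA, hB, hC, ?_⟩
    apply mul_left_cancel₀ hg.ne'
    rw [b2] at b1
    linear_combination -b1 - Int.gcdA γ (δ - α) * k * hA - Int.gcdB γ (δ - α) * k * hB - l * hC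
  have hr : BQF.IsReduced ⟨A, B, C⟩ := by
    refine ⟨pos_of_mul_pos_right (rA ▸ hγ) hg.le, ?_, ?_⟩
    · by_contra! hc
      have : 0 ≤ g * C := mul_nonneg hg.le hc
      omega
    · by_contra! hc
      have : 0 ≤ g * (A + C - B) := mul_nonneg hg.le (by simp only at hc; omega)
      have : g * (A + C - B) = γ + -β - (δ - α) := by rw [rA, rC, rB]; ring
      omega
  refine ⟨⟨A, B, C⟩, hr, ⟨?_, ?_⟩, ⟨x, y, z, hxyz⟩, ?_⟩
  · have := mul_pos hr.1 (neg_pos.mpr hr.2.1)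
    simp only [BQF.disc] at this ⊢
    nlinarith [sq_nonneg B]
  -- A square discriminant m² would give two positive squares, (α + δ)² and (gm)², differing by
  -- exactly 4, which is impossible.
  · rintro ⟨m, hm⟩
    have h1 : (α + δ) ^ 2 - (g * m) ^ 2 = 4 * e := by
      have : (g * m) ^ 2 = (δ - α) ^ 2 - 4 * γ * (-β) := by
        rw [rA, rB, rC]
        simp only [BQF.disc] at hm
        linear_combination -g ^ 2 * hm
      rw [this, hdet]; ring
    have hpos : 0 < (g * m) ^ 2 := by
      have : (g * m) ^ 2 = (δ - α) ^ 2 + 4 * (γ * β) := by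
        linear_combination -h1 - 4 * hdet
      have := mul_pos hγ hβ
      nlinarith [sq_nonneg (δ - α)]
    have h2 : (α + δ) ^ 2 - |g * m| ^ 2 = 4 * e := by rw [sq_abs]; exact h1
    have h3 : 0 < |g * m| := abs_pos.mpr (by rintro h; rw [h] at hpos; simp at hpos)
    have h4 : 0 < α + δ := by omega
    generalize |g * m| = M at *
    rcases mat2_det_sq hd with h | h
    · rw [← he] at h; rw [h] at h2
      have h5 : M < α + δ := by nlinarith
      have h6 : α + δ < M + 2 := by nlinarith
      have h7 : α + δ = M + 1 := by omega
      rw [h7] at h2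
      have : 2 * M + 1 = 4 := by linarith
      omega
    · rw [← he] at h; rw [h] at h2
      have h5 : α + δ < M := by nlinarith
      rcases lt_trichotomy M (α + δ + 1) with h6 | h6 | h6
      · omega
      · rw [h6] at h2
        have : 2 * (α + δ) + 1 = 4 := by linarith
        omega
      · have : (α + δ + 2) ^ 2 ≤ M ^ 2 := by gcongr; omega
        nlinarith
  · rw [hact]
    have key : ∀ X Y : ℤ, g * X = g * Y → X = Y := fun X Y h => mul_left_cancel₀ hg.ne' h
    ext
    · apply key
      simp only [BQF.tact, ← he, Matrix.of_apply, Matrix.cons_val', Matrix.cons_val_zero,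
        Matrix.cons_val_one, Matrix.cons_val_fin_one]
      linear_combination γ * hd - e * γ * hdet - e * α ^ 2 * rA - e * α * γ * rB
        - e * γ ^ 2 * rC + rA
    · apply key
      simp only [BQF.tact, ← he, Matrix.of_apply, Matrix.cons_val', Matrix.cons_val_zero,
        Matrix.cons_val_one, Matrix.cons_val_fin_one]
      linear_combination (δ - α) * hd - e * (δ - α) * hdet - e * 2 * α * β * rA
        - e * (α * δ + β * γ) * rB - e * 2 * γ * δ * rC + rB
    · apply key
      simp only [BQF.tact, ← he, Matrix.of_apply, Matrix.cons_val', Matrix.cons_val_zero,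
        Matrix.cons_val_one, Matrix.cons_val_fin_one]
      linear_combination -β * hd + e * β * hdet - e * β ^ 2 * rA
        - e * β * δ * rB - e * δ ^ 2 * rC + rC

/-! ### Realizing necklaces, orbits and their classes -/

namespace IndefForm

/-- The primitive form fixed by v has σ(f) as a prefix of v. The remainder r also fixes f, so it
commutes with σ(f); if r were nonempty, rotating v by |σ(f)| would fix v. -/
theorem exists_sigma_eq {v : List Bool} (hv : IsPrimitiveString v) (ht : true ∈ v) :
    ∃ f : IndefForm, f.IsZReduced ∧ f.1.IsPrimitive ∧ sigma f = v := by
  obtain ⟨F, hr, hi, hu, hF⟩ := exists_form_of_word ht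
  set f := ofF F hi
  have hfF : f.toF = F := toF_ofF F hi
  have hf : f.IsZReduced := by rw [← isReduced_toF_iff, hfF]; exact hr
  have hp : f.1.IsPrimitive := by rw [← isUnimodular_toF_iff, hfF]; exact hu
  rw [← hfF] at hF
  refine ⟨f, hf, hp, ?_⟩
  obtain ⟨r, rfl⟩ := sigma_prefix hf hp hv.1 hF
  by_contra hne
  have hrne : r ≠ [] := by rintro rfl; simp at hne
  have hr' : f.toF.wact r = f.toF := by rwa [BQF.wact_append, wact_sigma hf] at hF
  have hcomm : sigma f ++ r = r ++ sigma f := by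
    have hr := f.isReduced_toF_iff.mpr hf
    refine hr.eq_of_length_eq f.isIndef_toF (by rwa [hF]) ?_ (by simp [add_comm])
    rwa [BQF.wact_append, hr', wact_sigma hf]
  refine hv.2 (sigma f).length (List.length_pos_iff.mpr (sigma_spec hf).1) ?_ ?_
  · rw [List.length_append]
    have := List.length_pos_iff.mpr hrne
    omega
  · rw [List.rotate_append_length_eq, ← hcomm]

/-- Primitive reduced forms with the same necklace are connected by a string. -/
theorem exists_wact_of_cycle_eq {f g : IndefForm} (hf : f.IsZReduced) (hfp : f.1.IsPrimitive)
    (hg : g.IsZReduced) (hgp : g.1.IsPrimitive)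
    (h : ((sigma f : List Bool) : Cycle Bool) = (sigma g : List Bool)) :
    ∃ w : List Bool, f.toF.wact w = g.toF := by
  obtain ⟨n, hn, h⟩ := List.isRotated_iff_mod.mp (Cycle.coe_eq_coe.mp h.symm)
  rw [List.rotate_eq_drop_append_take hn] at h
  have hG := wact_sigma hg
  set p := (sigma g).take n
  set r := (sigma g).drop n
  have hpr : sigma g = p ++ r := (List.take_append_drop n _).symm
  rw [hpr] at hG
  have hgr := g.isReduced_toF_iff.mpr hg
  have hred : (g.toF.wact p).IsReduced :=
    hgr.wact_take g.isIndef_toF (w := r) (by rwa [hG])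
  have hfix : (g.toF.wact p).wact (sigma f) = g.toF.wact p := by
    rw [← h, ← BQF.wact_append, ← List.append_assoc, BQF.wact_append, hG]
  -- σ(g) = pr and σ(f) = rp, so g moved by p is fixed by σ(f), which determines a primitive reduced
  -- form.
  have e : g.toF.wact p = f.toF := hred.eq_of_wact_eq (g.isIndef_toF.wact p)
    ((g.isUnimodular_toF_iff.mpr hgp).tact (det_wordMat_sq p)) (f.isReduced_toF_iff.mpr hf)
    f.isIndef_toF (f.isUnimodular_toF_iff.mpr hfp) (sigma_spec hf).1 hfix (wact_sigma hf)
  exact ⟨r, by rw [← e, ← BQF.wact_append, hG]⟩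

/-- The reduced forms reached from `f` by strings. -/
def orbit (f : IndefForm) : Set IndefForm :=
  {g | g.IsZReduced ∧ ∃ w : List Bool, f.toF.wact w = g.toF}

theorem exists_take_of_wact {f g : IndefForm} (hf : f.IsZReduced) (hg : g.IsZReduced) (n : ℕ) :
    ∀ w : List Bool, w.length ≤ n → f.toF.wact w = g.toF →
      ∃ i < (sigma f).length, f.toF.wact ((sigma f).take i) = g.toF := by
  have hl : 0 < (sigma f).length := List.length_pos_iff.mpr (sigma_spec hf).1
  induction n with
  | zero =>
    intro w hw h
    obtain rfl : w = [] := List.length_eq_zero_iff.mp (by omega)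
    exact ⟨0, hl, by simpa using h⟩
  | succ n ih =>
    intro w hw h
    have hr := f.isReduced_toF_iff.mpr hf
    have h1 : (f.toF.wact w).IsReduced := by rw [h]; exact g.isReduced_toF_iff.mpr hg
    have h2 : (f.toF.wact (sigma f)).IsReduced := by rwa [wact_sigma hf]
    rcases lt_or_ge w.length (sigma f).length with hlt | hge
    · have := hr.prefix_of_length_le f.isIndef_toF h1 h2 hlt.le
      exact ⟨w.length, hlt, by rw [← List.prefix_iff_eq_take.mp this, h]⟩
    · obtain ⟨r, rfl⟩ := hr.prefix_of_length_le f.isIndef_toF h2 h1 hge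
      rw [BQF.wact_append, wact_sigma hf] at h
      exact ih r (by simp at hw; omega) h

/-- A coincidence would let a segment shorter than σ(f) fix a form of the orbit, whose shortest
period has the same length as σ(f). -/
theorem take_wact_lt {f : IndefForm} (hf : f.IsZReduced) (hp : f.1.IsPrimitive) {i j : ℕ}
    (hij : i < j) (hj : j < (sigma f).length) :
    f.toF.wact ((sigma f).take i) ≠ f.toF.wact ((sigma f).take j) := by
  intro h
  set v := sigma f with hv
  obtain ⟨r, hr⟩ : v.take i <+: v.take j := List.take_prefix_take_left hij.le
  have hlen : r.length = j - i := by
    have := congrArg List.length hr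
    simp at this
    omega
  have hrne : r ≠ [] := by rintro rfl; simp at hlen; omega
  have hred : (f.shift (v.take i)).IsZReduced := by
    rw [← isReduced_toF_iff, toF_shift]
    refine (f.isReduced_toF_iff.mpr hf).wact_take f.isIndef_toF (w := v.drop i) ?_
    rw [List.take_append_drop, wact_sigma hf]
    exact f.isReduced_toF_iff.mpr hf
  have hfix : (f.shift (v.take i)).toF.wact r = (f.shift (v.take i)).toF := by
    rw [toF_shift, ← BQF.wact_append, hr, h]
  have h1 := (sigma_prefix hred (isPrimitive_shift hp _) hrne hfix).length_le
  rw [length_sigma_eq hf hred (toF_shift _ _).symm, ← hv] at h1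
  omega

theorem encard_orbit {f : IndefForm} (hf : f.IsZReduced) (hp : f.1.IsPrimitive) :
    f.orbit.encard = (sigma f).length := by
  have himg : f.orbit = (fun i => f.shift ((sigma f).take i)) ''
      (Finset.range (sigma f).length : Set ℕ) := by
    ext g
    constructor
    · rintro ⟨hg, w, hw⟩
      obtain ⟨i, hi, h⟩ := exists_take_of_wact hf hg _ w le_rfl hw
      exact ⟨i, by simpa using hi, toF_injective (by simpa using h)⟩
    · rintro ⟨i, -, rfl⟩
      refine ⟨?_, _, (toF_shift _ _).symm⟩
      rw [← isReduced_toF_iff]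
      simp only [toF_shift]
      refine (f.isReduced_toF_iff.mpr hf).wact_take f.isIndef_toF (w := (sigma f).drop i) ?_
      rw [List.take_append_drop, wact_sigma hf]
      exact f.isReduced_toF_iff.mpr hf
  rw [himg, Set.InjOn.encard_image, Set.encard_coe_eq_coe_finsetCard, Finset.card_range]
  intro i hi j hj h
  simp only [Finset.coe_range, Set.mem_Iio] at hi hj
  have h' : f.toF.wact ((sigma f).take i) = f.toF.wact ((sigma f).take j) := by
    simpa using congrArg toF h
  rcases lt_trichotomy i j with hij | hij | hij
  · exact absurd h' (take_wact_lt hf hp hij hj)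
  · exact hij
  · exact absurd h'.symm (take_wact_lt hf hp hij hi)

theorem zForms_subset_orbit {f g : IndefForm} (hg : g ∈ f.orbit) :
    g.toClass.zForms ⊆ f.orbit := by
  obtain ⟨hgr, w, hw⟩ := hg
  rintro k ⟨hk, hkr⟩
  obtain ⟨w', hw', -⟩ := exists_wact_of_toClass_eq hgr hkr hk.symm
  exact ⟨hkr, w ++ w', by rw [BQF.wact_append, hw, hw']⟩

theorem sigmaBar_eq_of_mem_orbit {f g : IndefForm} (hf : f.IsZReduced) (hg : g ∈ f.orbit) :
    sigmaBar g.toClass = ((sigma f : List Bool) : Cycle Bool) := by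
  obtain ⟨hgr, w, hw⟩ := hg
  rw [sigma_cycle_eq hf hgr hw]
  exact (sigmaBar_eq ⟨rfl, hgr⟩).symm

theorem isPrimitive_of_mem_orbit {f g : IndefForm} (hp : f.1.IsPrimitive) (hg : g ∈ f.orbit) :
    g.toClass.IsPrimitive := by
  obtain ⟨-, w, hw⟩ := hg
  rw [isPrimitive_toClass_iff, ← isUnimodular_toF_iff, ← hw]
  exact (f.isUnimodular_toF_iff.mpr hp).tact (det_wordMat_sq w)

/-- A primitive class with the necklace of `f` has a representative in the orbit of `f`. -/
theorem exists_mem_orbit {f : IndefForm} (hf : f.IsZReduced) (hp : f.1.IsPrimitive)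
    {c : FormClass} (hc : c.IsPrimitive)
    (h : sigmaBar c = ((sigma f : List Bool) : Cycle Bool)) : ∃ g ∈ f.orbit, g.toClass = c :=
  ⟨c.zRep, ⟨c.zRep_mem.2, exists_wact_of_cycle_eq hf hp c.zRep_mem.2 (hc _ c.zRep_mem.1) h.symm⟩,
    c.zRep_mem.1⟩

/-- A connecting string of odd weight becomes one of even weight after a preliminary turn of σ(f).
-/
theorem toClass_eq_of_odd {f g : IndefForm} (hf : f.IsZReduced)
    (ho : Odd ((sigma f).count true)) (hg : g ∈ f.orbit) : f.toClass = g.toClass := by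
  obtain ⟨-, w, hw⟩ := hg
  by_cases he : Even (w.count true)
  · exact toClass_eq_of_wact hw he
  · refine toClass_eq_of_wact (w := sigma f ++ w) ?_ ?_
    · rw [BQF.wact_append, wact_sigma hf, hw]
    · rw [List.count_append]
      exact ho.add_odd (Nat.not_even_iff_odd.mp he)

/-- If the weight is even, the orbit meets exactly two classes. -/
theorem exists_two_classes {f : IndefForm} (hf : f.IsZReduced) (hp : f.1.IsPrimitive)
    (he : Even ((sigma f).count true)) (ht : true ∈ sigma f) :
    ∃ g ∈ f.orbit, f.toClass ≠ g.toClass ∧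
      ∀ k ∈ f.orbit, k.toClass = f.toClass ∨ k.toClass = g.toClass := by
  -- Cutting σ(f) just before or just after a 1 gives a prefix of odd weight; it leads to the second
  -- class.
  obtain ⟨p, r, hpr, hodd⟩ : ∃ p r : List Bool, sigma f = p ++ r ∧ Odd (p.count true) := by
    obtain ⟨a, b, hab⟩ := List.append_of_mem ht
    by_cases h : Even (a.count true)
    · exact ⟨a ++ [true], b, by simp [hab], by simpa using h.add_one⟩
    · exact ⟨a, true :: b, hab, Nat.not_even_iff_odd.mp h⟩
  have hrodd : Odd (r.count true) := by
    rw [hpr, List.count_append] at he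
    by_contra h
    exact Nat.not_even_iff_odd.mpr (hodd.add_even (Nat.not_odd_iff_even.mp h)) he
  have hfix := wact_sigma hf
  rw [hpr] at hfix
  have hgr : (f.shift p).IsZReduced := by
    rw [← isReduced_toF_iff, toF_shift]
    exact (f.isReduced_toF_iff.mpr hf).wact_take f.isIndef_toF (w := r)
      (by rw [hfix]; exact f.isReduced_toF_iff.mpr hf)
  refine ⟨f.shift p, ⟨hgr, p, (toF_shift _ _).symm⟩, ?_, ?_⟩
  · intro h
    obtain ⟨w, hw, hwe⟩ := exists_wact_of_toClass_eq hgr hf h.symm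
    -- If the classes agreed, p followed by an even return path would be a string of odd weight
    -- fixing f.
    have := even_count_of_wact_eq hf hp he _ (p ++ w) le_rfl
      (by rw [BQF.wact_append, ← toF_shift, hw])
    rw [List.count_append] at this
    exact Nat.not_even_iff_odd.mpr (hodd.add_even hwe) this
  · rintro k ⟨-, w, hw⟩
    by_cases hwe : Even (w.count true)
    · exact Or.inl (toClass_eq_of_wact hw hwe).symm
    · refine Or.inr (toClass_eq_of_wact (w := r ++ w) ?_ ?_).symm
      · rw [toF_shift, ← BQF.wact_append, ← List.append_assoc, BQF.wact_append, hfix, hw]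
      · rw [List.count_append]
        exact hrodd.add_odd (Nat.not_even_iff_odd.mp hwe)

theorem mem_orbit_self {f : IndefForm} (hf : f.IsZReduced) : f ∈ f.orbit :=
  ⟨hf, [], by simp⟩

end IndefForm

end ZNecklace

/-! ### The main theorem -/

open ZNecklace
theorem mainTheorem7 :
    -- every class contains Z-reduced forms, and its necklace does not depend on the chosen one
    (∀ c : FormClass, c.zForms.Nonempty ∧
      ∀ f ∈ c.zForms, ((sigma f : List Bool) : Cycle Bool) = sigmaBar c) ∧
    -- nor does the alternating necklace of a class of even weight
    (∀ (c : FormClass) (h : Even (weight (sigmaBar c))), ∀ f ∈ c.zForms,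
      ∀ hf : Even (weight ((sigma f : List Bool) : Cycle Bool)),
        altNecklace (sigma f) hf = altSigmaBar c h) ∧
    ∀ s : Cycle Bool, IsPrimitiveNecklace s →
      (Odd (weight s) →
        ∃ c : FormClass, {c' : FormClass | c'.IsPrimitive ∧ sigmaBar c' = s} = {c} ∧
          (s.length : ℕ∞) = c.zCaliber) ∧
      (Even (weight s) → weight s ≠ 0 →
        ∃ c₁ c₂ : FormClass, c₁ ≠ c₂ ∧
          {c' : FormClass | c'.IsPrimitive ∧
            ∃ h : Even (weight (sigmaBar c')), (altSigmaBar c' h).underlying = s} = {c₁, c₂} ∧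
          (s.length : ℕ∞) = c₁.zCaliber + c₂.zCaliber) := by
  refine ⟨fun c => ⟨c.zForms_nonempty, fun f hf => IndefForm.sigmaBar_eq hf⟩,
    fun c h f hf hf' => altNecklace_eq h hf hf', fun s hs => ?_⟩
  obtain ⟨v, rfl⟩ : ∃ v : List Bool, (v : Cycle Bool) = s := Quotient.exists_rep s
  have hprim := hs v rfl
  rw [weight_coe, Cycle.length_coe]
  constructor
  · intro ho
    obtain ⟨f, hf, hp, rfl⟩ := IndefForm.exists_sigma_eq hprim (List.count_pos_iff.mp ho.pos)
    refine ⟨f.toClass, ?_, ?_⟩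
    · ext c
      constructor
      · rintro ⟨hc, h⟩
        obtain ⟨g, hg, rfl⟩ := IndefForm.exists_mem_orbit hf hp hc h
        exact (IndefForm.toClass_eq_of_odd hf ho hg).symm
      · rintro rfl
        exact ⟨IndefForm.isPrimitive_of_mem_orbit hp (IndefForm.mem_orbit_self hf),
          IndefForm.sigmaBar_eq_of_mem_orbit hf (IndefForm.mem_orbit_self hf)⟩
    · rw [FormClass.zCaliber, ← IndefForm.encard_orbit hf hp]
      congr 1
      apply Set.Subset.antisymm
      · exact fun g hg => ⟨(IndefForm.toClass_eq_of_odd hf ho hg).symm, hg.1⟩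
      · exact IndefForm.zForms_subset_orbit (IndefForm.mem_orbit_self hf)
  · intro he h0
    have ht : true ∈ v := List.count_pos_iff.mp (Nat.pos_of_ne_zero h0)
    obtain ⟨f, hf, hp, rfl⟩ := IndefForm.exists_sigma_eq hprim ht
    obtain ⟨g, hg, hne, hcov⟩ := IndefForm.exists_two_classes hf hp he ht
    have hunder : ∀ (c : FormClass) (h : Even (weight (sigmaBar c))),
        (altSigmaBar c h).underlying = sigmaBar c := fun c h => underlying_altNecklace _ h
    have hmem : ∀ k ∈ f.orbit, k.toClass.IsPrimitive ∧
        ∃ h : Even (weight (sigmaBar k.toClass)),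
          (altSigmaBar k.toClass h).underlying = ((sigma f : List Bool) : Cycle Bool) := by
      intro k hk
      have e := IndefForm.sigmaBar_eq_of_mem_orbit hf hk
      exact ⟨IndefForm.isPrimitive_of_mem_orbit hp hk, by rwa [e, weight_coe],
        by rw [hunder, e]⟩
    refine ⟨f.toClass, g.toClass, hne, ?_, ?_⟩
    · ext c
      constructor
      · rintro ⟨hc, h, hs'⟩
        rw [hunder] at hs'
        obtain ⟨k, hk, rfl⟩ := IndefForm.exists_mem_orbit hf hp hc hs'
        exact hcov k hk
      · rintro (rfl | rfl)
        · exact hmem f (IndefForm.mem_orbit_self hf)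
        · exact hmem g hg
    · rw [FormClass.zCaliber, FormClass.zCaliber, ← IndefForm.encard_orbit hf hp,
        ← Set.encard_union_eq]
      · congr 1
        apply Set.Subset.antisymm
        · intro k hk
          rcases hcov k hk with h | h
          · exact Or.inl ⟨h, hk.1⟩
          · exact Or.inr ⟨h, hk.1⟩
        · exact Set.union_subset
            (IndefForm.zForms_subset_orbit (IndefForm.mem_orbit_self hf))
            (IndefForm.zForms_subset_orbit hg)
      · rw [Set.disjoint_left]
        rintro k ⟨h1, -⟩ ⟨h2, -⟩
        exact hne (h1.symm.trans h2)
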